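/- Norms are operator 2-norms. Consider floating point arithmetic with machine epsilon $\varepsilon$ in the standard model: the computed result of each operation $+,-,\times,/,\sqrt{\ }$ is $x(1+\delta)$ with $|\delta|\le\varepsilon$, where $x$ is the exact result of the operation (no overflow or underflow). Suppose we are given a multiplication procedure for square matrices that is stable: for $n\times n$ matrices $A,B$ the computed product satisfies $$\|C_{\rm comp}-AB\|\le \mu(n)\,\varepsilon\,\|A\|\,\|B\|+O(\varepsilon^2)\,\|A\|\,\|B\|,\qquad \mu(n)=O(n^{c'}),$$ where the constant in $O(\varepsilon^2)$ may depend on $n$. Rectangular products are computed by cutting the factors into square blocks (padded with zeros at the border) whose size is the smallest dimension involved, multiplying the blocks with the given procedure, and adding the block products in floating point. Let $[R,W,Y]=QRR(A)$ be the recursive QR decomposition of an $n\times m$ matrix $A$, $n\ge m\ge1$. It represents the orthogonal factor by $Q^T=I-WY$. If $m=1$, then $W,Y$ form a Householder transformation, normalized so that $\|W\|=1$, $Y=2W^T$, with $R=\pm\|A\|$ (for $A=0$: $W=e_1$, $Y=2e_1^T$, $R=0$). If $m\ge2$, let $k=\lfloor m/2\rfloor$ and $A=[A_L,A_R]$ with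 $k$ columns in $A_L$. Then compute, in order: (a) $[R_L,W_L,Y_L]=QRR(A_L)$; (b) $\begin{bmatrix}A_{12}\\A_{22}\end{bmatrix}=A_R-W_L(Y_LA_R)$, where $A_{12}$ has $k$ rows; (c) $[R_R,W_R,Y_R]=QRR(A_{22})$; (d) $X=W_L-\begin{bmatrix}0\\W_R(Y_RW_{L,2})\end{bmatrix}$, where $W_{L,2}$ consists of the last $n-k$ rows of $W_L$; and return $$R=\begin{bmatrix}R_L&A_{12}\\0&R_R\end{bmatrix},\quad W=\Big[X,\begin{bmatrix}0\\W_R\end{bmatrix}\Big],\quad Y=\begin{bmatrix}Y_L\\ [0,\,Y_R]\end{bmatrix}.$$ For square $A$ write $[Q,R]=QRR(A)$ when $Q=(I-WY)^T$ is then formed explicitly. For an $n\times n$ matrix $A$, the algorithm $[U,R,V]=RURV(A)$ draws an $n\times n$ matrix $B$ (with i.i.d. $N(0,1)$ entries) and computes $[V,R_0]=QRR(B)$, then $\hat A=A\,V^T$, then $[U,R]=QRR(\hat A)$. Claim. There are constants $K,c$, depending only on the multiplication procedure, such that for every $n$ there is $\varepsilon_0>0$ with the following property. For every $0<\varepsilon\le\varepsilon_0$,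 every real $n\times n$ matrix $A$, every value of the drawn matrix $B$, and every result $[U,R,V]$ that $RURV(A)$ may compute in floating point arithmetic with machine epsilon $\varepsilon$, there are exactly orthogonal matrices $\hat U,\hat V$ and a matrix $\delta A$ with $$A+\delta A=\hat U R\hat V,\qquad \|\delta A\|\le Kn^c\varepsilon\,\|A\|,\qquad \|U-\hat U\|\le Kn^c\varepsilon,\qquad \|V-\hat V\|\le Kn^c\varepsilon .$$ -/

import Mathlib

open scoped Matrix.Norms.L2Operator

/-! Matrix norms `‖·‖` below are the operator 2-norm (largest singular value). -/

noncomputable section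

namespace FloatURV

/-- Standard model of rounding (no overflow or underflow): `y` is a possible rounded value of the
exact result `x` of one arithmetic operation, in arithmetic with machine epsilon `ε`. -/
def FlRound (ε x y : ℝ) : Prop := ∃ δ : ℝ, |δ| ≤ ε ∧ y = x * (1 + δ)

/-- `FlSum ε s r`: `r` is a possible floating point sum of the numbers in `s`; the
additions may be carried out in any order. -/
inductive FlSum (ε : ℝ) : Multiset ℝ → ℝ → Prop
  | empty : FlSum ε 0 0
  | single (a : ℝ) : FlSum ε {a} a
  | add {s t : Multiset ℝ} {a b c : ℝ} (hs : s ≠ 0) (ht : t ≠ 0)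
      (ha : FlSum ε s a) (hb : FlSum ε t b) (hc : FlRound ε (a + b) c) : FlSum ε (s + t) c

/-- `C` is a possible floating point value of `A - B`. -/
def FlSub {m n : ℕ} (ε : ℝ) (A B C : Matrix (Fin m) (Fin n) ℝ) : Prop :=
  ∀ i j, FlRound ε (A i j - B i j) (C i j)

/-- A floating point multiplication procedure for square matrices: `mm ε n A B C` says that,
run with machine epsilon `ε` on the `n`-by-`n` matrices `A` and `B`, it may return `C`. -/
abbrev SquareMul : Type :=
  (ε : ℝ) → (n : ℕ) → (A B C : Matrix (Fin n) (Fin n) ℝ) → Prop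

/-- Stability of a multiplication procedure:
`‖C_comp - A B‖ ≤ μ(n) ε ‖A‖ ‖B‖ + O(ε²)` with `μ(n) = O(n ^ c)`. The second order term is
relative to `‖A‖ ‖B‖`, and its constant may depend on `n`. -/
def StableMul (mm : SquareMul) : Prop :=
  ∃ (μ : ℕ → ℝ) (K : ℝ) (c : ℕ), (∀ n, μ n ≤ K * (n : ℝ) ^ c) ∧
    ∀ n : ℕ, ∃ K₂ ε₀ : ℝ, 0 < ε₀ ∧ ∀ ε : ℝ, 0 < ε → ε ≤ ε₀ →
      ∀ A B C : Matrix (Fin n) (Fin n) ℝ, mm ε n A B C →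
        ‖C - A * B‖ ≤ μ n * ε * (‖A‖ * ‖B‖) + K₂ * ε ^ 2 * (‖A‖ * ‖B‖)

/-- The `(I, J)` block of size `d`-by-`d` of `A`, padded with zeros at the border. -/
def block {p q : ℕ} (d : ℕ) (A : Matrix (Fin p) (Fin q) ℝ) (I J : ℕ) :
    Matrix (Fin d) (Fin d) ℝ :=
  Matrix.of fun a b =>
    if h : I * d + (a : ℕ) < p ∧ J * d + (b : ℕ) < q then
      A ⟨I * d + (a : ℕ), h.1⟩ ⟨J * d + (b : ℕ), h.2⟩
    else 0

/-- Block size used for a `p`-by-`q` times `q`-by-`r` product: the smallest dimension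
(`1` if a dimension is zero). -/
def blockSize (p q r : ℕ) : ℕ := max 1 (min p (min q r))

/-- `C` is a possible computed product of the rectangular matrices `A` and `B`: they are cut into
square blocks whose size is the smallest dimension, the blocks are multiplied by `mm`, and
the block products are added in floating point. If all matrices are square, this is one call
of `mm`. -/
def FlMul (mm : SquareMul) (ε : ℝ) {p q r : ℕ} (A : Matrix (Fin p) (Fin q) ℝ)
    (B : Matrix (Fin q) (Fin r) ℝ) (C : Matrix (Fin p) (Fin r) ℝ) : Prop :=
  ∃ P : ℕ → ℕ → ℕ → Matrix (Fin (blockSize p q r)) (Fin (blockSize p q r)) ℝ,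
    (∀ I J K : ℕ, I * blockSize p q r < p → J * blockSize p q r < q → K * blockSize p q r < r →
      mm ε (blockSize p q r) (block (blockSize p q r) A I J) (block (blockSize p q r) B J K)
        (P I J K)) ∧
    ∀ (I K : ℕ) (a b : Fin (blockSize p q r)) (hi : I * blockSize p q r + (a : ℕ) < p)
      (hk : K * blockSize p q r + (b : ℕ) < r),
      FlSum ε ((Multiset.range (q ⌈/⌉ blockSize p q r)).map fun J => P I J K a b)
        (C ⟨I * blockSize p q r + (a : ℕ), hi⟩ ⟨K * blockSize p q r + (b : ℕ), hk⟩)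

/-- `s` is a possible floating point value of the Euclidean norm of `v`. -/
def FlNorm (ε : ℝ) {n : ℕ} (v : Fin n → ℝ) (s : ℝ) : Prop :=
  ∃ (sq : Fin n → ℝ) (t : ℝ), (∀ i, FlRound ε (v i * v i) (sq i)) ∧
    FlSum ε (Finset.univ.val.map sq) t ∧ FlRound ε (√t) s

/-- The sign used in a Householder transformation, with `sgn 0 = 1`. -/
def sgn (x : ℝ) : ℝ := if 0 ≤ x then 1 else -1

/-- Floating point Householder transformation for one column `x`. With `s` the computed norm of
`x`, the vector `v = x + sgn(x₁) s e₁` is normalized to `W`, `Y` is twice `Wᵀ`, and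
`R = -sgn(x₁) s`; exactly, `(I - W Y) x = R e₁`. If the computed norm is zero, then
`W = e₁`, `Y = 2 e₁ᵀ` and `R = 0`. -/
def FlHouseholder (ε : ℝ) {n : ℕ} (x : Matrix (Fin (n + 1)) (Fin 1) ℝ)
    (R : Matrix (Fin 1) (Fin 1) ℝ) (W : Matrix (Fin (n + 1)) (Fin 1) ℝ)
    (Y : Matrix (Fin 1) (Fin (n + 1)) ℝ) : Prop :=
  ∃ s : ℝ, FlNorm ε (fun i => x i 0) s ∧
    ((s = 0 ∧ R 0 0 = 0 ∧ (∀ i, W i 0 = if i = 0 then 1 else 0) ∧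
        ∀ i, Y 0 i = if i = 0 then 2 else 0) ∨
      (s ≠ 0 ∧ R 0 0 = -(sgn (x 0 0) * s) ∧
        ∃ (v : Fin (n + 1) → ℝ) (ν : ℝ),
          FlRound ε (x 0 0 + sgn (x 0 0) * s) (v 0) ∧ (∀ i, i ≠ 0 → v i = x i 0) ∧
          FlNorm ε v ν ∧ (∀ i, FlRound ε (v i / ν) (W i 0)) ∧
          ∀ i, FlRound ε (2 * W i 0) (Y 0 i)))

/-- `[A, B]`. -/
def hcat {n k l : ℕ} (A : Matrix (Fin n) (Fin k) ℝ) (B : Matrix (Fin n) (Fin l) ℝ) :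
    Matrix (Fin n) (Fin (k + l)) ℝ :=
  (Matrix.fromCols A B).submatrix id finSumFinEquiv.symm

/-- `[A; B]`. -/
def vcat {k p m : ℕ} (A : Matrix (Fin k) (Fin m) ℝ) (B : Matrix (Fin p) (Fin m) ℝ) :
    Matrix (Fin (k + p)) (Fin m) ℝ :=
  (Matrix.fromRows A B).submatrix finSumFinEquiv.symm id

/-- The recursive QR decomposition in floating point: `FlQRR mm ε n m A R W Y` says that
`[R, W, Y]` may be the computed output of `QRR(A)` for the `n`-by-`m` matrix `A`. A single
column is treated by a Householder transformation. Otherwise `A = [A_L, A_R]` with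
`k = ⌊m / 2⌋` columns in `A_L` and `l = ⌈m / 2⌉` columns in `A_R`, and `n = k + p`. -/
inductive FlQRR (mm : SquareMul) (ε : ℝ) : (n m : ℕ) → Matrix (Fin n) (Fin m) ℝ →
    Matrix (Fin m) (Fin m) ℝ → Matrix (Fin n) (Fin m) ℝ → Matrix (Fin m) (Fin n) ℝ → Prop
  | column {n : ℕ} {x : Matrix (Fin (n + 1)) (Fin 1) ℝ} {R : Matrix (Fin 1) (Fin 1) ℝ}
      {W : Matrix (Fin (n + 1)) (Fin 1) ℝ} {Y : Matrix (Fin 1) (Fin (n + 1)) ℝ}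
      (h : FlHouseholder ε x R W Y) : FlQRR mm ε (n + 1) 1 x R W Y
  | split {k l p : ℕ} (hk : 0 < k) (hkl : k = (k + l) / 2) (hlp : l ≤ p)
      {AL : Matrix (Fin (k + p)) (Fin k) ℝ} {AR : Matrix (Fin (k + p)) (Fin l) ℝ}
      -- (a) factor the left half
      {RL : Matrix (Fin k) (Fin k) ℝ} {WL : Matrix (Fin (k + p)) (Fin k) ℝ}
      {YL : Matrix (Fin k) (Fin (k + p)) ℝ}
      (hL : FlQRR mm ε (k + p) k AL RL WL YL)
      -- (b) update the right half: `[A12; A22] = AR - WL * (YL * AR)`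
      {S : Matrix (Fin k) (Fin l) ℝ} {T : Matrix (Fin (k + p)) (Fin l) ℝ}
      {A12 : Matrix (Fin k) (Fin l) ℝ} {A22 : Matrix (Fin p) (Fin l) ℝ}
      (hS : FlMul mm ε YL AR S) (hT : FlMul mm ε WL S T) (hA : FlSub ε AR T (vcat A12 A22))
      -- (c) factor the lower part of the right half
      {RR : Matrix (Fin l) (Fin l) ℝ} {WR : Matrix (Fin p) (Fin l) ℝ}
      {YR : Matrix (Fin l) (Fin p) ℝ}
      (hR : FlQRR mm ε p l A22 RR WR YR)
      -- (d) `X = WL - [0; WR * (YR * WL(k+1:n, 1:k))]`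
      {S' : Matrix (Fin l) (Fin k) ℝ} {T' : Matrix (Fin p) (Fin k) ℝ}
      {X : Matrix (Fin (k + p)) (Fin k) ℝ}
      (hS' : FlMul mm ε YR (WL.submatrix (Fin.natAdd k) id) S')
      (hT' : FlMul mm ε WR S' T') (hX : FlSub ε WL (vcat 0 T') X) :
      FlQRR mm ε (k + p) (k + l) (hcat AL AR) (vcat (hcat RL A12) (hcat 0 RR))
        (hcat X (vcat 0 WR)) (vcat YL (hcat 0 YR))

/-- `[Q, R] = QRR(A)` for a square matrix in floating point, where the orthogonal factor
`Q = (I - W Y)ᵀ` is multiplied out explicitly. -/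
def FlQR (mm : SquareMul) (ε : ℝ) {n : ℕ} (A Q R : Matrix (Fin n) (Fin n) ℝ) : Prop :=
  ∃ W Y P : Matrix (Fin n) (Fin n) ℝ,
    FlQRR mm ε n n A R W Y ∧ FlMul mm ε W Y P ∧ FlSub ε 1 P Q.transpose

/-- `[U, R, V]` may be the computed output of `RURV(A)` when `B` is the (Gaussian) matrix
that the algorithm draws:
`[V, R₀] = QRR(B)`, `Ahat = A * Vᵀ`, `[U, R] = QRR(Ahat)`. -/
def FlRURV (mm : SquareMul) (ε : ℝ) {n : ℕ} (A B U R V : Matrix (Fin n) (Fin n) ℝ) : Prop :=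
  ∃ R₀ Ahat : Matrix (Fin n) (Fin n) ℝ,
    FlQR mm ε B V R₀ ∧ FlMul mm ε A V.transpose Ahat ∧ FlQR mm ε Ahat U R

end FloatURV

end

open scoped Matrix.Norms.L2Operator
open Filter Topology

namespace FloatURV

/-! Every computed factor `1 - W * Y` stays close to some exactly orthogonal matrix, and errors are
measured against that matrix. Since orthogonal matrices do not increase norms, errors add along the
recursion instead of multiplying.

The induction is `FlQRR.qrrBound`. For `m` columns, each defect in `QRRBound` is at most `2 * m - 1`
fixed units: `D * ε` for orthogonality, `D₂ * ε * ‖A‖` for the residual. Merging `k` and `l` columns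
uses `(2 * k - 1) + (2 * l - 1)` units and leaves one for the rounding errors and second order terms
of the merge. The exact merge rests on `(1 - P) * (1 - W * Y) = 1 - ((W - P * W) * Y + P)`
(`norm_compact_sub_le`). As `1 - P` is nearly orthogonal, forming `X` barely increases the norm, so
`‖W‖` grows only linearly in `m` (`norm_compact_left_le`).

Two inputs feed the induction. `FlMul.norm_sub_le` transfers stability from square to rectangular
products with polynomial loss. `FlHouseholder.exists_orthogonal` is the base case: the sign choice
prevents cancellation, so `W` and `Y` are entrywise relative perturbations of an exact reflection.

In `FlRURV.exists_orthogonal`, `B` enters only through `V`, and only the near orthogonality of `V`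
matters. This is why the value of `B` is arbitrary. All smallness conditions on `ε` hold eventually
as `ε` tends to zero from the right, for each fixed `n`. -/

/-! ### Operator norms and orthogonal matrices -/

theorem abs_entry_le_norm {m n : Type*} [Fintype m] [Fintype n] [DecidableEq n]
    (A : Matrix m n ℝ) (i : m) (j : n) : |A i j| ≤ ‖A‖ := by
  have h := A.l2_opNorm_mulVec (EuclideanSpace.single j (1 : ℝ))
  have h2 := PiLp.norm_apply_le (WithLp.toLp 2 (A.mulVec (Pi.single j (1 : ℝ)))) i
  simp only [PiLp.norm_single, norm_one, mul_one] at h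
  refine le_trans ?_ (h2.trans h)
  simp

theorem norm_le_sqrt_sum_sq {m n : Type*} [Fintype m] [Fintype n] [DecidableEq n]
    (A : Matrix m n ℝ) : ‖A‖ ≤ √(∑ i, ∑ j, A i j ^ 2) := by
  rw [Matrix.l2_opNorm_def]
  refine ContinuousLinearMap.opNorm_le_bound _ (Real.sqrt_nonneg _) fun x => ?_
  rw [EuclideanSpace.norm_eq, EuclideanSpace.norm_eq, ← Real.sqrt_mul (by positivity)]
  refine Real.sqrt_le_sqrt ?_
  simp only [Real.norm_eq_abs, sq_abs]
  rw [Finset.sum_mul]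
  refine Finset.sum_le_sum fun i _ => ?_
  exact Finset.sum_mul_sq_le_sq_mul_sq Finset.univ (fun j => A i j) (fun j => x j)

/-- Comparison with the Frobenius norm. Passing from entries to operator norms costs one factor `N`,
harmless for polynomial bounds. -/
theorem norm_le_of_abs_entry_le {p q N : ℕ} (hp : p ≤ N) (hq : q ≤ N)
    (A : Matrix (Fin p) (Fin q) ℝ) {c : ℝ} (hc : 0 ≤ c) (h : ∀ i j, |A i j| ≤ c) :
    ‖A‖ ≤ N * c := by
  refine (norm_le_sqrt_sum_sq A).trans ?_
  rw [Real.sqrt_le_left (by positivity)]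
  have h1 : ∑ i, ∑ j, A i j ^ 2 ≤ ∑ _i : Fin p, ∑ _j : Fin q, c ^ 2 :=
    Finset.sum_le_sum fun i _ => Finset.sum_le_sum fun j _ =>
      sq_le_sq' (abs_le.1 (h i j)).1 (abs_le.1 (h i j)).2
  refine h1.trans ?_
  simp only [Finset.sum_const, Finset.card_univ, Fintype.card_fin, nsmul_eq_mul]
  have hp' : (p : ℝ) ≤ N := by exact_mod_cast hp
  have hq' : (q : ℝ) ≤ N := by exact_mod_cast hq
  rw [mul_pow, sq (N : ℝ), mul_assoc]
  gcongr

theorem norm_one_le (n : Type*) [Fintype n] [DecidableEq n] : ‖(1 : Matrix n n ℝ)‖ ≤ 1 := by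
  rw [← Matrix.diagonal_one, Matrix.l2_opNorm_diagonal]
  exact (pi_norm_le_iff_of_nonneg zero_le_one).2 fun i => by simp

theorem norm_le_one_of_transpose_mul_self {m n : Type*} [Fintype m] [Fintype n] [DecidableEq n]
    {A : Matrix m n ℝ} (h : A.transpose * A = 1) : ‖A‖ ≤ 1 := by
  have h1 := A.l2_opNorm_conjTranspose_mul_self
  rw [Matrix.conjTranspose_eq_transpose_of_trivial, h] at h1
  have := norm_one_le n
  nlinarith [norm_nonneg A]

theorem norm_transpose {m n : Type*} [Fintype m] [Fintype n] [DecidableEq n] [DecidableEq m]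
    (A : Matrix m n ℝ) : ‖A.transpose‖ = ‖A‖ := by
  rw [← Matrix.conjTranspose_eq_transpose_of_trivial, Matrix.l2_opNorm_conjTranspose]

theorem norm_orthogonal_le {n : Type*} [Fintype n] [DecidableEq n] {Q : Matrix n n ℝ}
    (hQ : Q ∈ Matrix.orthogonalGroup n ℝ) : ‖Q‖ ≤ 1 :=
  norm_le_one_of_transpose_mul_self ((Matrix.mem_orthogonalGroup_iff' n ℝ).1 hQ)

theorem norm_orthogonal_mul_le {n m : Type*} [Fintype n] [DecidableEq n] [Fintype m]
    [DecidableEq m] {Q : Matrix n n ℝ} (hQ : Q ∈ Matrix.orthogonalGroup n ℝ)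
    (A : Matrix n m ℝ) : ‖Q * A‖ ≤ ‖A‖ :=
  (Matrix.l2_opNorm_mul Q A).trans
    (mul_le_of_le_one_left (norm_nonneg _) (norm_orthogonal_le hQ))

theorem transpose_mem_orthogonalGroup {n : Type*} [Fintype n] [DecidableEq n] {Q : Matrix n n ℝ}
    (hQ : Q ∈ Matrix.orthogonalGroup n ℝ) : Q.transpose ∈ Matrix.orthogonalGroup n ℝ := by
  rw [Matrix.mem_orthogonalGroup_iff, Matrix.transpose_transpose]
  exact (Matrix.mem_orthogonalGroup_iff' n ℝ).1 hQ

/-- Selecting distinct rows is left multiplication by rows of the identity, whose transpose has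
orthonormal columns. -/
theorem norm_rows_le {m m' n : Type*} [Fintype m] [Fintype m'] [Fintype n] [DecidableEq m]
    [DecidableEq m'] [DecidableEq n] (A : Matrix m n ℝ) {f : m' → m} (hf : Function.Injective f) :
    ‖A.submatrix f id‖ ≤ ‖A‖ := by
  have h1 : A.submatrix f id = (1 : Matrix m m ℝ).submatrix f id * A := by
    ext i j
    simp [Matrix.mul_apply, Matrix.one_apply]
  have h2 : ‖(1 : Matrix m m ℝ).submatrix f id‖ ≤ 1 := by
    rw [← norm_transpose]
    refine norm_le_one_of_transpose_mul_self ?_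
    ext i j
    simp [Matrix.mul_apply, Matrix.one_apply, hf.eq_iff]
  rw [h1]
  exact (Matrix.l2_opNorm_mul _ _).trans (mul_le_of_le_one_left (norm_nonneg _) h2)

theorem norm_cols_le {m n n' : Type*} [Fintype m] [Fintype n] [Fintype n'] [DecidableEq m]
    [DecidableEq n'] [DecidableEq n] (A : Matrix m n ℝ) {f : n' → n} (hf : Function.Injective f) :
    ‖A.submatrix id f‖ ≤ ‖A‖ := by
  have := norm_rows_le A.transpose hf
  rwa [← Matrix.transpose_submatrix, norm_transpose, norm_transpose] at this

/-! ### Block matrices -/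

@[simp] theorem vcat_castAdd {k p m : ℕ} (A : Matrix (Fin k) (Fin m) ℝ)
    (B : Matrix (Fin p) (Fin m) ℝ) (i : Fin k) (j : Fin m) :
    vcat A B (Fin.castAdd p i) j = A i j := by simp [vcat]

@[simp] theorem vcat_natAdd {k p m : ℕ} (A : Matrix (Fin k) (Fin m) ℝ)
    (B : Matrix (Fin p) (Fin m) ℝ) (i : Fin p) (j : Fin m) :
    vcat A B (Fin.natAdd k i) j = B i j := by simp [vcat]

@[simp] theorem hcat_castAdd {n k l : ℕ} (A : Matrix (Fin n) (Fin k) ℝ)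
    (B : Matrix (Fin n) (Fin l) ℝ) (i : Fin n) (j : Fin k) :
    hcat A B i (Fin.castAdd l j) = A i j := by simp [hcat]

@[simp] theorem hcat_natAdd {n k l : ℕ} (A : Matrix (Fin n) (Fin k) ℝ)
    (B : Matrix (Fin n) (Fin l) ℝ) (i : Fin n) (j : Fin l) :
    hcat A B i (Fin.natAdd k j) = B i j := by simp [hcat]

theorem vcat_ext {k p m : ℕ} {A B : Matrix (Fin (k + p)) (Fin m) ℝ}
    (h1 : ∀ i j, A (Fin.castAdd p i) j = B (Fin.castAdd p i) j)
    (h2 : ∀ i j, A (Fin.natAdd k i) j = B (Fin.natAdd k i) j) : A = B := by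
  ext i j
  exact Fin.addCases (fun i => h1 i j) (fun i => h2 i j) i

theorem hcat_ext {n k l : ℕ} {A B : Matrix (Fin n) (Fin (k + l)) ℝ}
    (h1 : ∀ i j, A i (Fin.castAdd l j) = B i (Fin.castAdd l j))
    (h2 : ∀ i j, A i (Fin.natAdd k j) = B i (Fin.natAdd k j)) : A = B := by
  ext i j
  exact Fin.addCases (fun j => h1 i j) (fun j => h2 i j) j

theorem transpose_vcat {k p m : ℕ} (A : Matrix (Fin k) (Fin m) ℝ) (B : Matrix (Fin p) (Fin m) ℝ) :
    (vcat A B).transpose = hcat A.transpose B.transpose := by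
  refine hcat_ext ?_ ?_ <;> simp

theorem mul_hcat {n q k l : ℕ} (C : Matrix (Fin q) (Fin n) ℝ) (A : Matrix (Fin n) (Fin k) ℝ)
    (B : Matrix (Fin n) (Fin l) ℝ) : C * hcat A B = hcat (C * A) (C * B) := by
  refine hcat_ext ?_ ?_ <;> simp [Matrix.mul_apply]

theorem vcat_mul {k p m q : ℕ} (A : Matrix (Fin k) (Fin m) ℝ) (B : Matrix (Fin p) (Fin m) ℝ)
    (C : Matrix (Fin m) (Fin q) ℝ) : vcat A B * C = vcat (A * C) (B * C) := by
  refine vcat_ext ?_ ?_ <;> simp [Matrix.mul_apply]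

theorem hcat_mul_vcat {n k l m : ℕ} (A : Matrix (Fin n) (Fin k) ℝ) (B : Matrix (Fin n) (Fin l) ℝ)
    (C : Matrix (Fin k) (Fin m) ℝ) (D : Matrix (Fin l) (Fin m) ℝ) :
    hcat A B * vcat C D = A * C + B * D := by
  ext i j
  simp [Matrix.mul_apply, Fin.sum_univ_add]

theorem hcat_sub {n k l : ℕ} (A A' : Matrix (Fin n) (Fin k) ℝ) (B B' : Matrix (Fin n) (Fin l) ℝ) :
    hcat A B - hcat A' B' = hcat (A - A') (B - B') := by
  refine hcat_ext ?_ ?_ <;> simp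

theorem vcat_sub {m k l : ℕ} (A A' : Matrix (Fin k) (Fin m) ℝ) (B B' : Matrix (Fin l) (Fin m) ℝ) :
    vcat A B - vcat A' B' = vcat (A - A') (B - B') := by
  refine vcat_ext ?_ ?_ <;> simp

theorem norm_vcat_zero_le {k p m : ℕ} (B : Matrix (Fin p) (Fin m) ℝ) :
    ‖vcat (0 : Matrix (Fin k) (Fin m) ℝ) B‖ ≤ ‖B‖ := by
  have h : vcat (0 : Matrix (Fin k) (Fin m) ℝ) B
      = (1 : Matrix (Fin (k + p)) (Fin (k + p)) ℝ).submatrix id (Fin.natAdd k) * B := by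
    refine vcat_ext ?_ ?_ <;> intro i j <;>
      simp [Matrix.mul_apply, Matrix.one_apply, Fin.ext_iff]
    · refine (Finset.sum_eq_zero fun x _ => if_neg ?_).symm
      have := i.2
      omega
    · simp [← Fin.ext_iff]
  rw [h]
  refine (Matrix.l2_opNorm_mul _ _).trans (mul_le_of_le_one_left (norm_nonneg _) ?_)
  exact (norm_cols_le _ (Fin.natAdd_injective p k)).trans (norm_one_le _)

theorem norm_vcat_le_zero {k p m : ℕ} (A : Matrix (Fin k) (Fin m) ℝ) :
    ‖vcat A (0 : Matrix (Fin p) (Fin m) ℝ)‖ ≤ ‖A‖ := by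
  have h : vcat A (0 : Matrix (Fin p) (Fin m) ℝ)
      = (1 : Matrix (Fin (k + p)) (Fin (k + p)) ℝ).submatrix id (Fin.castAdd p) * A := by
    refine vcat_ext ?_ ?_ <;> intro i j <;>
      simp [Matrix.mul_apply, Matrix.one_apply, Fin.ext_iff]
    · simp [← Fin.ext_iff]
    · refine (Finset.sum_eq_zero fun x _ => if_neg ?_).symm
      have := x.2
      omega
  rw [h]
  refine (Matrix.l2_opNorm_mul _ _).trans (mul_le_of_le_one_left (norm_nonneg _) ?_)
  exact (norm_cols_le _ (Fin.castAdd_injective k p)).trans (norm_one_le _)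

theorem norm_vcat_le {k p m : ℕ} (A : Matrix (Fin k) (Fin m) ℝ) (B : Matrix (Fin p) (Fin m) ℝ) :
    ‖vcat A B‖ ≤ ‖A‖ + ‖B‖ := by
  have h : vcat A B = vcat A 0 + vcat 0 B := by
    refine vcat_ext ?_ ?_ <;> simp
  rw [h]
  exact (norm_add_le _ _).trans (add_le_add (norm_vcat_le_zero A) (norm_vcat_zero_le B))

theorem norm_hcat_le {k p m : ℕ} (A : Matrix (Fin m) (Fin k) ℝ) (B : Matrix (Fin m) (Fin p) ℝ) :
    ‖hcat A B‖ ≤ ‖A‖ + ‖B‖ := by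
  have h := norm_vcat_le A.transpose B.transpose
  rw [← norm_transpose, transpose_vcat] at h
  simpa [norm_transpose] using h

theorem norm_hcat_zero_le {k p m : ℕ} (B : Matrix (Fin m) (Fin p) ℝ) :
    ‖hcat (0 : Matrix (Fin m) (Fin k) ℝ) B‖ ≤ ‖B‖ := by
  simpa using norm_hcat_le (0 : Matrix (Fin m) (Fin k) ℝ) B

theorem norm_le_hcat_left {k p m : ℕ} (A : Matrix (Fin m) (Fin k) ℝ)
    (B : Matrix (Fin m) (Fin p) ℝ) : ‖A‖ ≤ ‖hcat A B‖ := by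
  have h := norm_cols_le (hcat A B) (Fin.castAdd_injective k p)
  convert h using 2
  ext i j
  simp

theorem norm_le_hcat_right {k p m : ℕ} (A : Matrix (Fin m) (Fin k) ℝ)
    (B : Matrix (Fin m) (Fin p) ℝ) : ‖B‖ ≤ ‖hcat A B‖ := by
  have h := norm_cols_le (hcat A B) (Fin.natAdd_injective p k)
  convert h using 2
  ext i j
  simp

theorem norm_le_vcat_right {k p m : ℕ} (A : Matrix (Fin k) (Fin m) ℝ)
    (B : Matrix (Fin p) (Fin m) ℝ) : ‖B‖ ≤ ‖vcat A B‖ := by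
  have h := norm_rows_le (vcat A B) (Fin.natAdd_injective p k)
  convert h using 2
  ext i j
  simp

/-- The block diagonal matrix `diag(1, Q)`. -/
def oneDiag (k : ℕ) {p : ℕ} (Q : Matrix (Fin p) (Fin p) ℝ) :
    Matrix (Fin (k + p)) (Fin (k + p)) ℝ :=
  hcat (vcat 1 0) (vcat 0 Q)

theorem oneDiag_mul_vcat {k p m : ℕ} (Q : Matrix (Fin p) (Fin p) ℝ) (A : Matrix (Fin k) (Fin m) ℝ)
    (B : Matrix (Fin p) (Fin m) ℝ) : oneDiag k Q * vcat A B = vcat A (Q * B) := by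
  rw [oneDiag, hcat_mul_vcat, vcat_mul, vcat_mul]
  refine vcat_ext ?_ ?_ <;> simp

theorem transpose_oneDiag {k p : ℕ} (Q : Matrix (Fin p) (Fin p) ℝ) :
    (oneDiag k Q).transpose = oneDiag k Q.transpose := by
  refine vcat_ext ?_ ?_ <;> intro i j <;> refine Fin.addCases (fun j => ?_) (fun j => ?_) j <;>
    simp [oneDiag, Matrix.one_apply, eq_comm]

theorem oneDiag_one (k p : ℕ) : oneDiag k (1 : Matrix (Fin p) (Fin p) ℝ) = 1 := by
  refine vcat_ext ?_ ?_ <;> intro i j <;> refine Fin.addCases (fun j => ?_) (fun j => ?_) j <;>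
    simp [oneDiag, Matrix.one_apply, Fin.ext_iff] <;> omega

theorem oneDiag_mul {k p : ℕ} (Q Q' : Matrix (Fin p) (Fin p) ℝ) :
    oneDiag k Q * oneDiag k Q' = oneDiag k (Q * Q') := by
  rw [oneDiag.eq_def k Q', mul_hcat, oneDiag_mul_vcat, oneDiag_mul_vcat]
  simp [oneDiag]

theorem oneDiag_mem_orthogonalGroup (k : ℕ) {p : ℕ} {Q : Matrix (Fin p) (Fin p) ℝ}
    (hQ : Q ∈ Matrix.orthogonalGroup (Fin p) ℝ) :
    oneDiag k Q ∈ Matrix.orthogonalGroup (Fin (k + p)) ℝ := by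
  rw [Matrix.mem_orthogonalGroup_iff] at hQ ⊢
  rw [transpose_oneDiag, oneDiag_mul, hQ, oneDiag_one]

theorem one_sub_vcat_mul_hcat {k p l : ℕ} (W : Matrix (Fin p) (Fin l) ℝ)
    (Y : Matrix (Fin l) (Fin p) ℝ) :
    1 - vcat (0 : Matrix (Fin k) (Fin l) ℝ) W * hcat 0 Y = oneDiag k (1 - W * Y) := by
  rw [mul_hcat, vcat_mul, vcat_mul, ← oneDiag_one]
  refine vcat_ext ?_ ?_ <;> intro i j <;> refine Fin.addCases (fun j => ?_) (fun j => ?_) j <;>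
    simp [oneDiag]

theorem norm_oneDiag_sub_le {k p : ℕ} (Q Q' : Matrix (Fin p) (Fin p) ℝ) :
    ‖oneDiag k Q - oneDiag k Q'‖ ≤ ‖Q - Q'‖ := by
  rw [oneDiag, oneDiag, hcat_sub, vcat_sub, vcat_sub, sub_self, sub_self, sub_self]
  have h : vcat (0 : Matrix (Fin k) (Fin k) ℝ) (0 : Matrix (Fin p) (Fin k) ℝ) = 0 := by
    refine vcat_ext ?_ ?_ <;> simp
  rw [h]
  exact (norm_hcat_zero_le _).trans (norm_vcat_zero_le _)

/-- The `n`-by-`m` matrix `[R; 0]`. -/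
def padRows (n : ℕ) {m : ℕ} (R : Matrix (Fin m) (Fin m) ℝ) : Matrix (Fin n) (Fin m) ℝ :=
  Matrix.of fun i j => if h : (i : ℕ) < m then R ⟨i, h⟩ j else 0

theorem padRows_self {n : ℕ} (R : Matrix (Fin n) (Fin n) ℝ) : padRows n R = R := by
  ext i j
  simp [padRows]

theorem padRows_add {k p : ℕ} (R : Matrix (Fin k) (Fin k) ℝ) :
    padRows (k + p) R = vcat R 0 := by
  refine vcat_ext ?_ ?_ <;> simp [padRows]

theorem padRows_block {k l p : ℕ} (RL : Matrix (Fin k) (Fin k) ℝ) (A12 : Matrix (Fin k) (Fin l) ℝ)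
    (RR : Matrix (Fin l) (Fin l) ℝ) :
    padRows (k + p) (vcat (hcat RL A12) (hcat 0 RR))
      = hcat (vcat RL 0) (vcat A12 (padRows p RR)) := by
  refine vcat_ext ?_ ?_ <;> intro i j
  · have h : ((Fin.castAdd p i : Fin (k + p)) : ℕ) < k + l := by simp; omega
    have e : padRows (k + p) (vcat (hcat RL A12) (hcat 0 RR)) (Fin.castAdd p i) j
        = vcat (hcat RL A12) (hcat 0 RR) (Fin.castAdd l i) j := dif_pos h
    rw [e]
    refine Fin.addCases (fun j => ?_) (fun j => ?_) j <;> simp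
  · by_cases h : (i : ℕ) < l
    · have h' : ((Fin.natAdd k i : Fin (k + p)) : ℕ) < k + l := by simpa using h
      have e : padRows (k + p) (vcat (hcat RL A12) (hcat 0 RR)) (Fin.natAdd k i) j
          = vcat (hcat RL A12) (hcat 0 RR) (Fin.natAdd k ⟨i, h⟩) j := dif_pos h'
      rw [e, vcat_natAdd]
      refine Fin.addCases (fun j => ?_) (fun j => ?_) j <;> simp [padRows, h]
    · refine Fin.addCases (fun j => ?_) (fun j => ?_) j <;> simp [padRows, h]

/-! ### Rounding errors of sums, products and differences -/

theorem FlSum.abs_sub_le {ε : ℝ} (hε : 0 ≤ ε) {s : Multiset ℝ} {r : ℝ} (h : FlSum ε s r) :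
    |r - s.sum| ≤ ((1 + ε) ^ s.card - 1) * (s.map abs).sum := by
  induction h with
  | empty => simp
  | single a => simp; positivity
  | @add s t a b c hs ht ha hb hc iha ihb =>
    obtain ⟨δ, hδ, rfl⟩ := hc
    -- One more rounding turns `(1 + ε) ^ u.card - 1` into `(1 + ε) ^ (u.card + 1) - 1`. The other
    -- summand is nonempty, so the exponent `u.card + v.card` pays for it in any order of summation.
    have step : ∀ u v : Multiset ℝ, v ≠ 0 →
        ((1 + ε) ^ u.card - 1) * (1 + ε) + ε ≤ (1 + ε) ^ (u.card + v.card) - 1 := by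
      intro u v hv
      have h1 : (1 + ε) ^ (u.card + 1) ≤ (1 + ε) ^ (u.card + v.card) :=
        pow_le_pow_right₀ (by linarith) (by have := Multiset.card_pos.2 hv; omega)
      rw [pow_succ] at h1
      linarith
    have hS : |s.sum| ≤ (s.map abs).sum := Multiset.abs_sum_le_sum_abs
    have hT : |t.sum| ≤ (t.map abs).sum := Multiset.abs_sum_le_sum_abs
    have hs1 := mul_le_mul_of_nonneg_right (step s t ht) ((abs_nonneg _).trans hS)
    have ht1 := mul_le_mul_of_nonneg_right (step t s hs) ((abs_nonneg _).trans hT)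
    rw [add_comm t.card] at ht1
    have hδ' := abs_le.1 hδ
    have h1 : |1 + δ| ≤ 1 + ε := abs_le.2 ⟨by linarith, by linarith⟩
    have key : (a + b) * (1 + δ) - (s + t).sum
        = (a - s.sum) * (1 + δ) + (b - t.sum) * (1 + δ) + (s.sum * δ + t.sum * δ) := by
      rw [Multiset.sum_add]; ring
    rw [key, Multiset.card_add, Multiset.map_add, Multiset.sum_add]
    have e1 : |(a - s.sum) * (1 + δ)|
        ≤ ((1 + ε) ^ s.card - 1) * (s.map abs).sum * (1 + ε) := by
      rw [abs_mul]
      exact mul_le_mul iha h1 (abs_nonneg _) ((abs_nonneg _).trans iha)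
    have e2 : |(b - t.sum) * (1 + δ)|
        ≤ ((1 + ε) ^ t.card - 1) * (t.map abs).sum * (1 + ε) := by
      rw [abs_mul]
      exact mul_le_mul ihb h1 (abs_nonneg _) ((abs_nonneg _).trans ihb)
    have e3 : |s.sum * δ| ≤ (s.map abs).sum * ε := by
      rw [abs_mul]
      exact mul_le_mul hS hδ (abs_nonneg _) ((abs_nonneg _).trans hS)
    have e4 : |t.sum * δ| ≤ (t.map abs).sum * ε := by
      rw [abs_mul]
      exact mul_le_mul hT hδ (abs_nonneg _) ((abs_nonneg _).trans hT)
    have t1 := abs_add_le ((a - s.sum) * (1 + δ) + (b - t.sum) * (1 + δ))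
      (s.sum * δ + t.sum * δ)
    have t2 := abs_add_le ((a - s.sum) * (1 + δ)) ((b - t.sum) * (1 + δ))
    have t3 := abs_add_le (s.sum * δ) (t.sum * δ)
    nlinarith

theorem one_add_pow_sub_one_le {ε : ℝ} (hε : 0 ≤ ε) {k N : ℕ} (hk : k ≤ N)
    (h : (N : ℝ) * ε ≤ 1) : (1 + ε) ^ k - 1 ≤ 2 * (N * ε) := by
  have h1 : (1 + ε) ^ k ≤ (1 + ε) ^ N := pow_le_pow_right₀ (by linarith) hk
  have h2 : (1 + ε) ^ N ≤ Real.exp (N * ε) := by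
    rw [Real.exp_nat_mul]
    exact pow_le_pow_left₀ (by linarith) (by linarith [Real.add_one_le_exp ε]) N
  have h0 : 0 ≤ (N : ℝ) * ε := by positivity
  have h3 := Real.abs_exp_sub_one_le (x := N * ε) (by rwa [abs_of_nonneg h0])
  rw [abs_of_nonneg h0] at h3
  have := (abs_le.1 h3).2
  linarith

theorem FlSum.abs_sub_le_of_card_le {ε : ℝ} (hε : 0 ≤ ε) {s : Multiset ℝ} {r : ℝ}
    (h : FlSum ε s r) {N : ℕ} (hs : s.card ≤ N) (hN : (N : ℝ) * ε ≤ 1) :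
    |r - s.sum| ≤ 2 * (N * ε) * (s.map abs).sum :=
  (h.abs_sub_le hε).trans (mul_le_mul_of_nonneg_right (one_add_pow_sub_one_le hε hs hN)
    (Multiset.sum_nonneg fun x hx => by
      obtain ⟨y, _, rfl⟩ := Multiset.mem_map.1 hx
      exact abs_nonneg y))

theorem sum_range_mul_eq (f : ℕ → ℝ) (d Q : ℕ) :
    ∑ j ∈ Finset.range (Q * d), f j
      = ∑ J ∈ Finset.range Q, ∑ b ∈ Finset.range d, f (J * d + b) := by
  induction Q with
  | zero => simp
  | succ Q ih => rw [Finset.sum_range_succ, ← ih, add_mul, one_mul, Finset.sum_range_add]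

theorem norm_block_le {p q d N : ℕ} (hd : d ≤ N) (A : Matrix (Fin p) (Fin q) ℝ) (I J : ℕ) :
    ‖block d A I J‖ ≤ N * ‖A‖ := by
  refine norm_le_of_abs_entry_le hd hd _ (norm_nonneg _) fun a b => ?_
  simp only [block, Matrix.of_apply]
  split_ifs
  · exact abs_entry_le_norm A _ _
  · simp

/-- Write the inner index as `J * d + b`. Its range is first extended by zero terms to a multiple of
`d`, which matches the zero padding of `block`. -/
theorem sum_block_mul_block {p q r d : ℕ} (hd : 0 < d) (A : Matrix (Fin p) (Fin q) ℝ)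
    (B : Matrix (Fin q) (Fin r) ℝ) (I K : ℕ) (a b : Fin d) (hi : I * d + (a : ℕ) < p)
    (hk : K * d + (b : ℕ) < r) :
    ∑ J ∈ Finset.range (q ⌈/⌉ d), (block d A I J * block d B J K) a b
      = (A * B) ⟨I * d + a, hi⟩ ⟨K * d + b, hk⟩ := by
  set f : ℕ → ℝ := fun j => if h : j < q then
    A ⟨I * d + a, hi⟩ ⟨j, h⟩ * B ⟨j, h⟩ ⟨K * d + b, hk⟩ else 0 with hf
  have h1 : (A * B) ⟨I * d + a, hi⟩ ⟨K * d + b, hk⟩ = ∑ j ∈ Finset.range q, f j := by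
    rw [Matrix.mul_apply, ← Fin.sum_univ_eq_sum_range]
    exact Finset.sum_congr rfl fun j _ => by simp [hf]
  have hq : q ≤ q ⌈/⌉ d * d := by
    have := le_smul_ceilDiv (b := q) hd
    rwa [smul_eq_mul, mul_comm] at this
  have h2 : ∑ j ∈ Finset.range q, f j = ∑ j ∈ Finset.range (q ⌈/⌉ d * d), f j := by
    refine Finset.sum_subset (Finset.range_mono hq) fun j _ hj => ?_
    simp only [hf]
    exact dif_neg (by simpa using hj)
  rw [h1, h2, sum_range_mul_eq]
  refine Finset.sum_congr rfl fun J _ => ?_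
  rw [Matrix.mul_apply, ← Fin.sum_univ_eq_sum_range]
  refine Finset.sum_congr rfl fun j _ => ?_
  by_cases h : J * d + (j : ℕ) < q <;> simp [block, hf, h, hi, hk]

theorem blockSize_pos (p q r : ℕ) : 0 < blockSize p q r := by simp [blockSize]

theorem blockSize_le {p q r N : ℕ} (hN : 1 ≤ N) (hp : p ≤ N) : blockSize p q r ≤ N := by
  simp [blockSize, hN, hp]

/-- Entrywise, the error is that of at most `N` block products plus that of adding them. Blocks are
bounded crudely by `N` times the full norm. -/
theorem FlMul.norm_sub_le {mm : SquareMul} {ε κ : ℝ} {N : ℕ} (hN : 1 ≤ N) (hε : 0 ≤ ε)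
    (hNε : (N : ℝ) * ε ≤ 1) (hκ : 0 ≤ κ) (hκε : κ * ε ≤ 1)
    (hmm : ∀ d ≤ N, ∀ A B C : Matrix (Fin d) (Fin d) ℝ, mm ε d A B C →
      ‖C - A * B‖ ≤ κ * ε * (‖A‖ * ‖B‖))
    {p q r : ℕ} (hp : p ≤ N) (hq : q ≤ N) (hr : r ≤ N) {A : Matrix (Fin p) (Fin q) ℝ}
    {B : Matrix (Fin q) (Fin r) ℝ} {C : Matrix (Fin p) (Fin r) ℝ} (h : FlMul mm ε A B C) :
    ‖C - A * B‖ ≤ (4 + κ) * N ^ 5 * ε * (‖A‖ * ‖B‖) := by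
  obtain ⟨P, hP, hC⟩ := h
  have hd := blockSize_pos p q r
  have hdN : blockSize p q r ≤ N := blockSize_le hN hp
  generalize blockSize p q r = d at *
  have hN' : (1 : ℝ) ≤ N := by exact_mod_cast hN
  set Z := ‖A‖ * ‖B‖ with hZ
  have hZ0 : 0 ≤ Z := by positivity
  have hQ : q ⌈/⌉ d ≤ N := by
    refine le_trans ?_ hq
    rw [ceilDiv_le_iff_le_smul hd, smul_eq_mul]
    exact Nat.le_mul_of_pos_left q hd
  have hQ' : ((q ⌈/⌉ d : ℕ) : ℝ) ≤ N := by exact_mod_cast hQ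
  have hblk : ∀ I J K : ℕ, ‖block d A I J‖ * ‖block d B J K‖ ≤ N ^ 2 * Z := by
    intro I J K
    calc ‖block d A I J‖ * ‖block d B J K‖ ≤ (N * ‖A‖) * (N * ‖B‖) :=
          mul_le_mul (norm_block_le hdN A I J) (norm_block_le hdN B J K) (norm_nonneg _)
            (by positivity)
      _ = N ^ 2 * Z := by rw [hZ]; ring
  have main : ∀ i k, |(C - A * B) i k| ≤ (4 + κ) * N ^ 4 * ε * Z := by
    intro i k
    -- Quotient and remainder by `d` locate the entry in its block; they are then generalized so
    -- that only these two equations remain.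
    have hi : i.1 / d * d + ((⟨i.1 % d, Nat.mod_lt _ hd⟩ : Fin d) : ℕ) = i :=
      Nat.div_add_mod' i.1 d
    have hk : k.1 / d * d + ((⟨k.1 % d, Nat.mod_lt _ hd⟩ : Fin d) : ℕ) = k :=
      Nat.div_add_mod' k.1 d
    have hi' := hi ▸ i.2
    have hk' := hk ▸ k.2
    generalize (⟨i.1 % d, Nat.mod_lt _ hd⟩ : Fin d) = a at hi hi'
    generalize (⟨k.1 % d, Nat.mod_lt _ hd⟩ : Fin d) = b at hk hk'
    generalize i.1 / d = I at hi hi'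
    generalize k.1 / d = K at hk hk'
    have ei : i = ⟨I * d + a, hi'⟩ := Fin.ext hi.symm
    have ek : k = ⟨K * d + b, hk'⟩ := Fin.ext hk.symm
    have hsum := (hC I K a b hi' hk').abs_sub_le_of_card_le hε (N := N) (by simpa using hQ) hNε
    rw [← ei, ← ek] at hsum
    rw [Multiset.map_map] at hsum
    change |C i k - ∑ J ∈ Finset.range (q ⌈/⌉ d), P I J K a b|
      ≤ 2 * (N * ε) * ∑ J ∈ Finset.range (q ⌈/⌉ d), |P I J K a b| at hsum
    have hAB := sum_block_mul_block hd A B I K a b hi' hk'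
    rw [← ei, ← ek] at hAB
    have hloc : ∀ J ∈ Finset.range (q ⌈/⌉ d),
        |P I J K a b - (block d A I J * block d B J K) a b| ≤ κ * ε * (N ^ 2 * Z) := by
      intro J hJ
      have hJq : J * d < q := by
        by_contra hcon
        have := Finset.mem_range.1 hJ
        have h3 : q ⌈/⌉ d ≤ J := by
          rw [ceilDiv_le_iff_le_smul hd, smul_eq_mul, mul_comm]
          omega
        omega
      have h1 := hmm d hdN _ _ _ (hP I J K (by omega) hJq (by omega))
      refine ((abs_entry_le_norm (P I J K - block d A I J * block d B J K) a b).trans h1).trans ?_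
      exact mul_le_mul_of_nonneg_left (hblk I J K) (by positivity)
    have hPabs : ∀ J ∈ Finset.range (q ⌈/⌉ d), |P I J K a b| ≤ 2 * (N ^ 2 * Z) := by
      intro J hJ
      have h1 := hloc J hJ
      have h2 : |(block d A I J * block d B J K) a b| ≤ N ^ 2 * Z :=
        ((abs_entry_le_norm _ a b).trans (Matrix.l2_opNorm_mul _ _)).trans (hblk I J K)
      have h3 : κ * ε * (N ^ 2 * Z) ≤ 1 * (N ^ 2 * Z) :=
        mul_le_mul_of_nonneg_right hκε (by positivity)
      have h4 := abs_sub_abs_le_abs_sub (P I J K a b) ((block d A I J * block d B J K) a b)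
      linarith
    have s1 : ∑ J ∈ Finset.range (q ⌈/⌉ d), |P I J K a b| ≤ N * (2 * (N ^ 2 * Z)) := by
      refine (Finset.sum_le_sum hPabs).trans ?_
      rw [Finset.sum_const, Finset.card_range, nsmul_eq_mul]
      exact mul_le_mul_of_nonneg_right hQ' (by positivity)
    have s2 : |∑ J ∈ Finset.range (q ⌈/⌉ d), P I J K a b - (A * B) i k|
        ≤ N * (κ * ε * (N ^ 2 * Z)) := by
      rw [← hAB, ← Finset.sum_sub_distrib]
      refine (Finset.abs_sum_le_sum_abs _ _).trans ((Finset.sum_le_sum hloc).trans ?_)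
      rw [Finset.sum_const, Finset.card_range, nsmul_eq_mul]
      exact mul_le_mul_of_nonneg_right hQ' (by positivity)
    have s3 : 2 * (N * ε) * ∑ J ∈ Finset.range (q ⌈/⌉ d), |P I J K a b|
        ≤ 2 * (N * ε) * (N * (2 * (N ^ 2 * Z))) :=
      mul_le_mul_of_nonneg_left s1 (by positivity)
    -- A spare factor `N` brings both error terms to the common power `N ^ 4`.
    have s4 : (N : ℝ) * (κ * ε * (N ^ 2 * Z)) ≤ N * (N * (κ * ε * (N ^ 2 * Z))) :=
      le_mul_of_one_le_left (by positivity) hN'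
    rw [Matrix.sub_apply]
    refine (abs_sub_le _ _ _).trans ((add_le_add (hsum.trans s3) (s2.trans s4)).trans ?_)
    apply le_of_eq
    ring
  refine (norm_le_of_abs_entry_le hp hr _ (by positivity) main).trans (le_of_eq ?_)
  ring

theorem eventually_mul_le_one (κ : ℝ) : ∀ᶠ ε in 𝓝[>] (0 : ℝ), κ * ε ≤ 1 := by
  have h : Tendsto (fun ε : ℝ => κ * ε) (𝓝 0) (𝓝 (κ * 0)) := (continuous_const_mul κ).tendsto 0
  rw [mul_zero] at h
  exact (tendsto_nhdsWithin_of_tendsto_nhds h).eventually (eventually_le_nhds zero_lt_one)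

theorem StableMul.exists_norm_sub_le {mm : SquareMul} (h : StableMul mm) :
    ∃ (C : ℝ) (e : ℕ), 0 ≤ C ∧ ∀ N : ℕ, 1 ≤ N → ∀ᶠ ε in 𝓝[>] (0 : ℝ),
      ∀ p q r : ℕ, p ≤ N → q ≤ N → r ≤ N → ∀ (A : Matrix (Fin p) (Fin q) ℝ)
        (B : Matrix (Fin q) (Fin r) ℝ) (D : Matrix (Fin p) (Fin r) ℝ), FlMul mm ε A B D →
        ‖D - A * B‖ ≤ C * N ^ e * ε * (‖A‖ * ‖B‖) := by
  obtain ⟨μ, K, c, hμ, hs⟩ := h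
  refine ⟨5 + |K|, c + 5, by positivity, fun N hN => ?_⟩
  have hN' : (1 : ℝ) ≤ N := by exact_mod_cast hN
  -- The `+ 1` absorbs the second order term once `K₂ * ε ≤ 1`; the absolute value makes the bound
  -- monotone in the block size.
  set κ : ℝ := |K| * N ^ c + 1 with hκ
  have hκ0 : 0 ≤ κ := by positivity
  have hloc : ∀ d : ℕ, d ≤ N → ∀ᶠ ε in 𝓝[>] (0 : ℝ),
      ∀ A B C : Matrix (Fin d) (Fin d) ℝ, mm ε d A B C →
        ‖C - A * B‖ ≤ κ * ε * (‖A‖ * ‖B‖) := by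
    intro d hd
    obtain ⟨K₂, ε₀, hε₀, hb⟩ := hs d
    filter_upwards [Ioc_mem_nhdsGT hε₀, eventually_mul_le_one K₂] with ε hε hK₂ A B C hC
    refine (hb ε hε.1 hε.2 A B C hC).trans ?_
    have h1 : μ d ≤ |K| * N ^ c := by
      refine (hμ d).trans ?_
      have hd' : (d : ℝ) ≤ N := by exact_mod_cast hd
      have : (d : ℝ) ^ c ≤ N ^ c := pow_le_pow_left₀ (by positivity) hd' c
      exact mul_le_mul (le_abs_self K) this (by positivity) (abs_nonneg _)
    have h2 : K₂ * ε ^ 2 ≤ 1 * ε := by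
      rw [sq, ← mul_assoc]
      exact mul_le_mul_of_nonneg_right hK₂ hε.1.le
    rw [← add_mul]
    refine mul_le_mul_of_nonneg_right ?_ (by positivity)
    rw [hκ, add_mul]
    exact add_le_add (mul_le_mul_of_nonneg_right h1 hε.1.le) h2
  -- The threshold for `ε` depends on the block size, but only finitely many sizes occur.
  have hall : ∀ᶠ ε in 𝓝[>] (0 : ℝ), ∀ d ∈ Finset.range (N + 1),
      ∀ A B C : Matrix (Fin d) (Fin d) ℝ, mm ε d A B C →
        ‖C - A * B‖ ≤ κ * ε * (‖A‖ * ‖B‖) :=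
    (Filter.eventually_all_finset _).2 fun d hd =>
      hloc d (Nat.lt_succ_iff.1 (Finset.mem_range.1 hd))
  filter_upwards [hall, eventually_mul_le_one κ, eventually_mul_le_one N, self_mem_nhdsWithin]
    with ε h1 h2 h3 h4 p q r hp hq hr A B D hD
  have hε : 0 ≤ ε := le_of_lt h4
  refine (FlMul.norm_sub_le hN hε h3 hκ0 h2
    (fun d hd => h1 d (Finset.mem_range.2 (Nat.lt_succ_of_le hd))) hp hq hr hD).trans ?_
  refine mul_le_mul_of_nonneg_right (mul_le_mul_of_nonneg_right ?_ hε) (by positivity)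
  have h5 : (4 + κ) ≤ (5 + |K|) * N ^ c := by
    have : (1 : ℝ) ≤ N ^ c := one_le_pow₀ hN'
    rw [hκ]
    nlinarith
  calc (4 + κ) * (N : ℝ) ^ 5 ≤ (5 + |K|) * N ^ c * N ^ 5 :=
        mul_le_mul_of_nonneg_right h5 (by positivity)
    _ = (5 + |K|) * N ^ (c + 5) := by rw [pow_add]; ring

theorem FlSub.norm_sub_le {m n N : ℕ} (hm : m ≤ N) (hn : n ≤ N) {ε : ℝ} (hε : 0 ≤ ε)
    {A B C : Matrix (Fin m) (Fin n) ℝ} (h : FlSub ε A B C) :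
    ‖C - (A - B)‖ ≤ N * ε * ‖A - B‖ := by
  rw [mul_assoc]
  refine norm_le_of_abs_entry_le hm hn _ (by positivity) fun i j => ?_
  obtain ⟨δ, hδ, hC⟩ := h i j
  have : (C - (A - B)) i j = δ * (A - B) i j := by
    simp only [Matrix.sub_apply, hC]; ring
  rw [this, abs_mul]
  exact mul_le_mul hδ (abs_entry_le_norm _ i j) (abs_nonneg _) hε

/-! ### Calculus of relative perturbations -/

theorem FlRound.abs_sub_le {τ x y : ℝ} (h : FlRound τ x y) : |y - x| ≤ τ * |x| := by
  obtain ⟨δ, hδ, rfl⟩ := h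
  rw [show x * (1 + δ) - x = δ * x by ring, abs_mul]
  exact mul_le_mul_of_nonneg_right hδ (abs_nonneg _)

theorem FlRound.of_abs_sub_le {τ x y : ℝ} (hτ : 0 ≤ τ) (h : |y - x| ≤ τ * |x|) :
    FlRound τ x y := by
  rcases eq_or_ne x 0 with rfl | hx
  · refine ⟨0, by simpa using hτ, ?_⟩
    have : |y - 0| ≤ 0 := by simpa using h
    simpa using this
  · refine ⟨(y - x) / x, ?_, by field_simp; ring⟩
    rw [abs_div]
    exact (div_le_iff₀ (abs_pos.2 hx)).2 h

theorem FlRound.refl {τ : ℝ} (hτ : 0 ≤ τ) (x : ℝ) : FlRound τ x x :=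
  ⟨0, by simpa using hτ, by simp⟩

theorem abs_add_add_mul_le {a b δ η : ℝ} (hδ : |δ| ≤ a) (hη : |η| ≤ b) :
    |δ + η + δ * η| ≤ a + b + a * b := by
  have h1 : |δ * η| ≤ a * b := by
    rw [abs_mul]
    exact mul_le_mul hδ hη (abs_nonneg _) ((abs_nonneg _).trans hδ)
  exact (abs_add_le _ _).trans (add_le_add ((abs_add_le _ _).trans (add_le_add hδ hη)) h1)

theorem FlRound.trans {a b c x y z : ℝ} (h : FlRound a x y) (h' : FlRound b y z)
    (hc : a + b + a * b ≤ c) : FlRound c x z := by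
  obtain ⟨δ, hδ, rfl⟩ := h
  obtain ⟨η, hη, rfl⟩ := h'
  exact ⟨δ + η + δ * η, (abs_add_add_mul_le hδ hη).trans hc, by ring⟩

theorem FlRound.mul {a b c x x' y y' : ℝ} (h : FlRound a x x') (h' : FlRound b y y')
    (hc : a + b + a * b ≤ c) : FlRound c (x * y) (x' * y') := by
  obtain ⟨δ, hδ, rfl⟩ := h
  obtain ⟨η, hη, rfl⟩ := h'
  exact ⟨δ + η + δ * η, (abs_add_add_mul_le hδ hη).trans hc, by ring⟩

theorem FlRound.div {a b c x x' y y' : ℝ} (h : FlRound a x x') (h' : FlRound b y y')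
    (hb : b ≤ 1 / 2) (hc : 2 * (a + b) ≤ c) : FlRound c (x / y) (x' / y') := by
  obtain ⟨δ, hδ, rfl⟩ := h
  obtain ⟨η, hη, rfl⟩ := h'
  have hη' := abs_le.1 hη
  have hpos : 1 / 2 ≤ 1 + η := by linarith
  refine ⟨(δ - η) / (1 + η), ?_, ?_⟩
  · rw [abs_div, abs_of_nonneg (by linarith : (0 : ℝ) ≤ 1 + η), div_le_iff₀ (by linarith)]
    have h1 : |δ - η| ≤ a + b := (abs_sub _ _).trans (add_le_add hδ hη)
    have h0 := (abs_nonneg _).trans h1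
    nlinarith
  · have : (1 + η) ≠ 0 := by linarith
    rw [mul_div_mul_comm]
    congr 1
    field_simp
    ring

/-- From `(√(1 + δ) - 1) * (√(1 + δ) + 1) = δ`, where the second factor is at least `1`. -/
theorem FlRound.sqrt {a x y : ℝ} (h : FlRound a x y) (hx : 0 ≤ x) (ha : a ≤ 1) :
    FlRound a (√x) (√y) := by
  obtain ⟨δ, hδ, rfl⟩ := h
  have hδ' := abs_le.1 hδ
  refine ⟨√(1 + δ) - 1, le_trans ?_ hδ, by rw [Real.sqrt_mul hx]; ring⟩
  have h0 : 0 ≤ 1 + δ := by linarith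
  have h1 := Real.sq_sqrt h0
  have h2 := Real.sqrt_nonneg (1 + δ)
  have h3 : (√(1 + δ) - 1) * (√(1 + δ) + 1) = δ := by linarith
  calc |√(1 + δ) - 1| ≤ |√(1 + δ) - 1| * |√(1 + δ) + 1| := by
        refine le_mul_of_one_le_right (abs_nonneg _) ?_
        rw [abs_of_nonneg (by linarith)]
        linarith
    _ = |δ| := by rw [← abs_mul, h3]

/-- Nonnegative terms cannot cancel, so the relative error of the sum is no worse than that of the
terms. -/
theorem FlRound.sum {a : ℝ} {n : ℕ} {x y : Fin n → ℝ} (ha : 0 ≤ a) (hx : ∀ i, 0 ≤ x i)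
    (h : ∀ i, FlRound a (x i) (y i)) : FlRound a (∑ i, x i) (∑ i, y i) := by
  refine FlRound.of_abs_sub_le ha ?_
  rw [← Finset.sum_sub_distrib, abs_of_nonneg (Finset.sum_nonneg fun i _ => hx i), Finset.mul_sum]
  refine (Finset.abs_sum_le_sum_abs _ _).trans (Finset.sum_le_sum fun i _ => ?_)
  have := (h i).abs_sub_le
  rwa [abs_of_nonneg (hx i)] at this

theorem FlNorm.flRound {ε : ℝ} (hε : 0 ≤ ε) {n N : ℕ} (hn : n ≤ N) (hN : 1 ≤ N)
    (hNε : (N : ℝ) * ε ≤ 1 / 1000) {v : Fin n → ℝ} {s : ℝ} (h : FlNorm ε v s) :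
    FlRound (6 * (N * ε)) (√(∑ i, v i ^ 2)) s := by
  obtain ⟨sq, t, h1, h2, h3⟩ := h
  have hN' : (1 : ℝ) ≤ N := by exact_mod_cast hN
  have hετ : ε ≤ N * ε := le_mul_of_one_le_left hε hN'
  set τ := (N : ℝ) * ε
  have hsq : ∀ i, 0 ≤ sq i := by
    intro i
    obtain ⟨δ, hδ, h⟩ := h1 i
    rw [h]
    have := abs_le.1 hδ
    exact mul_nonneg (mul_self_nonneg _) (by linarith)
  have e1 : FlRound ε (∑ i, v i ^ 2) (∑ i, sq i) :=
    FlRound.sum hε (fun i => sq_nonneg _) fun i => by simpa [_root_.sq] using h1 i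
  have e2 : FlRound (2 * τ) (∑ i, sq i) t := by
    refine FlRound.of_abs_sub_le (by linarith) ?_
    have := h2.abs_sub_le_of_card_le hε (N := N) (by simpa using hn) (by linarith)
    rw [Multiset.map_map] at this
    change |t - ∑ i, sq i| ≤ 2 * τ * ∑ i, |sq i| at this
    rw [abs_of_nonneg (Finset.sum_nonneg fun i _ => hsq i)]
    simpa only [abs_of_nonneg (hsq _)] using this
  have e3 : FlRound (4 * τ) (∑ i, v i ^ 2) t := e1.trans e2 (by nlinarith)
  exact (e3.sqrt (Finset.sum_nonneg fun i _ => sq_nonneg _) (by linarith)).trans h3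
    (by nlinarith)

/-! ### Householder transformations -/

theorem reflection_mem_orthogonalGroup {n : ℕ} {w : Matrix (Fin n) (Fin 1) ℝ}
    (hw : w.transpose * w = 1) :
    1 - (2 : ℝ) • (w * w.transpose) ∈ Matrix.orthogonalGroup (Fin n) ℝ := by
  have h1 : w * w.transpose * (w * w.transpose) = w * w.transpose := by
    rw [Matrix.mul_assoc, ← Matrix.mul_assoc w.transpose, hw, Matrix.one_mul]
  rw [Matrix.mem_orthogonalGroup_iff]
  simp only [Matrix.transpose_sub, Matrix.transpose_one, Matrix.transpose_smul,
    Matrix.transpose_mul, Matrix.transpose_transpose, sub_mul, mul_sub, Matrix.smul_mul,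
    Matrix.mul_smul, h1, one_mul, mul_one]
  module

theorem reflection_rounded {n N : ℕ} (hn : n ≤ N) {τ : ℝ} (hτ : 0 ≤ τ) (hτ' : τ ≤ 1 / 1000)
    {w W : Matrix (Fin n) (Fin 1) ℝ} {Y : Matrix (Fin 1) (Fin n) ℝ} (hw : ∑ i, w i 0 ^ 2 = 1)
    (hW : ∀ i, FlRound (70 * τ) (w i 0) (W i 0)) (hY : ∀ i, FlRound (72 * τ) (2 * w i 0) (Y 0 i)) :
    ‖1 - W * Y - (1 - (2 : ℝ) • (w * w.transpose))‖ ≤ 300 * N * τ ∧ ‖W‖ ≤ 2 ∧ ‖Y‖ ≤ 3 := by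
  have hw1 : ∀ i, |w i 0| ≤ 1 := by
    intro i
    rw [← sq_le_one_iff_abs_le_one, ← hw]
    exact Finset.single_le_sum (f := fun i => w i 0 ^ 2) (fun i _ => sq_nonneg _)
      (Finset.mem_univ i)
  refine ⟨?_, ?_, ?_⟩
  · rw [show 300 * (N : ℝ) * τ = N * (300 * τ) by ring]
    refine norm_le_of_abs_entry_le hn hn _ (by positivity) fun i j => ?_
    have h := ((hW i).mul (hY j) (c := 150 * τ) (by nlinarith)).abs_sub_le
    have e : (1 - W * Y - (1 - (2 : ℝ) • (w * w.transpose)) : Matrix (Fin n) (Fin n) ℝ) i j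
        = -(W i 0 * Y 0 j - w i 0 * (2 * w j 0)) := by
      simp [Matrix.mul_apply]
      ring
    rw [e, abs_neg]
    refine h.trans ?_
    have h2 : |w i 0 * (2 * w j 0)| ≤ 2 := by
      rw [abs_mul, abs_mul, abs_two]
      have := mul_le_mul (hw1 i) (hw1 j) (abs_nonneg _) zero_le_one
      linarith
    nlinarith
  · refine (norm_le_sqrt_sum_sq W).trans ?_
    rw [Real.sqrt_le_left zero_le_two, show (2 : ℝ) ^ 2 = 4 * 1 by norm_num, ← hw, Finset.mul_sum]
    refine Finset.sum_le_sum fun i _ => ?_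
    obtain ⟨δ, hδ, h⟩ := hW i
    have h2 := abs_le.1 hδ
    rw [Fin.sum_univ_one, h, mul_pow, mul_comm]
    exact mul_le_mul_of_nonneg_right (by nlinarith) (sq_nonneg _)
  · refine (norm_le_sqrt_sum_sq Y).trans ?_
    rw [Real.sqrt_le_left (by norm_num), show (3 : ℝ) ^ 2 = 9 * 1 by norm_num, ← hw,
      Finset.mul_sum, Fin.sum_univ_one]
    refine Finset.sum_le_sum fun i _ => ?_
    obtain ⟨δ, hδ, h⟩ := hY i
    have h2 := abs_le.1 hδ
    have h3 : (1 + δ) ^ 2 * 4 ≤ 9 := by nlinarith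
    rw [h]
    nlinarith [mul_le_mul_of_nonneg_right h3 (sq_nonneg (w i 0))]

theorem sqrt_sum_sq_le_norm {n : ℕ} (x : Matrix (Fin n) (Fin 1) ℝ) :
    √(∑ i, x i 0 ^ 2) ≤ ‖x‖ := by
  rw [Real.sqrt_le_left (norm_nonneg _)]
  have h1 := x.l2_opNorm_conjTranspose_mul_self
  have h2 := (le_abs_self _).trans (abs_entry_le_norm (x.conjTranspose * x) 0 0)
  rw [h1] at h2
  simpa [Matrix.mul_apply, sq] using h2

theorem sgn_mul_sgn (x : ℝ) : sgn x * sgn x = 1 := by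
  unfold sgn
  split_ifs <;> norm_num

theorem abs_sgn (x : ℝ) : |sgn x| = 1 := by
  unfold sgn
  split_ifs <;> norm_num

theorem sgn_mul_self (x : ℝ) : sgn x * x = |x| := by
  unfold sgn
  split_ifs with h
  · rw [abs_of_nonneg h, one_mul]
  · rw [abs_of_neg (not_le.1 h), neg_one_mul]

theorem transpose_mul_self_eq_one {n : ℕ} {w : Matrix (Fin n) (Fin 1) ℝ}
    (hw : ∑ i, w i 0 ^ 2 = 1) : w.transpose * w = 1 := by
  ext i j
  rw [Subsingleton.elim i 0, Subsingleton.elim j 0]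
  simpa [Matrix.mul_apply, sq] using hw

/-- When `c` is the length of `u`, the hypothesis `hux` says that `x` and `x - u` have equal length,
so the reflection along `u` exchanges them. -/
theorem reflection_mul_column {n : ℕ} (x w u : Fin n → ℝ) (i : Fin n) (c : ℝ)
    (hw : ∀ i, w i = u i / c) (hc : c ≠ 0) (hux : 2 * ∑ i, u i * x i = c ^ 2) :
    x i - 2 * ∑ j, w i * w j * x j = x i - u i := by
  have h1 : ∑ j, w i * w j * x j = u i / c ^ 2 * ∑ j, u j * x j := by
    rw [Finset.mul_sum]
    refine Finset.sum_congr rfl fun j _ => ?_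
    rw [hw, hw]
    field_simp
  rw [h1, show 2 * (u i / c ^ 2 * ∑ j, u j * x j) = u i / c ^ 2 * (2 * ∑ j, u j * x j) by ring,
    hux]
  field_simp

theorem FlHouseholder.exists_orthogonal {ε : ℝ} (hε : 0 ≤ ε) {n N : ℕ} (hn : n + 1 ≤ N)
    (hNε : (N : ℝ) * ε ≤ 1 / 1000) {x : Matrix (Fin (n + 1)) (Fin 1) ℝ}
    {R : Matrix (Fin 1) (Fin 1) ℝ} {W : Matrix (Fin (n + 1)) (Fin 1) ℝ}
    {Y : Matrix (Fin 1) (Fin (n + 1)) ℝ} (h : FlHouseholder ε x R W Y) :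
    ∃ Q ∈ Matrix.orthogonalGroup (Fin (n + 1)) ℝ,
      ‖Q * x - padRows (n + 1) R‖ ≤ 300 * N ^ 2 * ε * ‖x‖ ∧
      ‖1 - W * Y - Q‖ ≤ 300 * N ^ 2 * ε ∧ ‖W‖ ≤ 2 ∧ ‖Y‖ ≤ 3 := by
  have hN : 1 ≤ N := by omega
  have hN' : (1 : ℝ) ≤ N := by exact_mod_cast hN
  have hετ : ε ≤ N * ε := le_mul_of_one_le_left hε hN'
  have hrw : 300 * (N : ℝ) ^ 2 * ε = 300 * N * (N * ε) := by ring
  rw [hrw]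
  obtain ⟨s, hs, h⟩ := h
  replace hs := hs.flRound hε hn hN hNε
  set τ := (N : ℝ) * ε with hτdef
  have hτ : 0 ≤ τ := by positivity
  set r := √(∑ i, x i 0 ^ 2) with hr
  have hsum0 : 0 ≤ ∑ i, x i 0 ^ 2 := Finset.sum_nonneg fun i _ => sq_nonneg _
  have hr2 : r ^ 2 = ∑ i, x i 0 ^ 2 := Real.sq_sqrt hsum0
  have hr0 : 0 ≤ r := Real.sqrt_nonneg _
  rcases h with ⟨h0, hR, hW, hY⟩ | ⟨h0, hR, v, ν, hv0, hv, hν, hW, hY⟩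
  · have hw : ∑ i, W i 0 ^ 2 = 1 := by simp [hW]
    obtain ⟨h1, h2, h3⟩ := reflection_rounded hn hτ hNε (w := W) (W := W) (Y := Y) hw
      (fun i => FlRound.refl (by positivity) _) fun i => by
        have : Y 0 i = 2 * W i 0 := by rw [hW, hY]; split_ifs <;> norm_num
        rw [this]
        exact FlRound.refl (by positivity) _
    -- The computed norm is the true one times a factor near `1`, so it vanishes only for `x = 0`.
    have hx : x = 0 := by
      have hrz : r = 0 := by
        obtain ⟨δ, hδ, h⟩ := hs
        have := abs_le.1 hδ
        rw [h0] at h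
        rcases mul_eq_zero.1 h.symm with h | h
        · exact h
        · linarith
      rw [hrz, zero_pow two_ne_zero, eq_comm,
        Finset.sum_eq_zero_iff_of_nonneg fun i _ => sq_nonneg _] at hr2
      ext i j
      rw [Subsingleton.elim j 0]
      simpa using hr2 i (Finset.mem_univ i)
    have hR0 : padRows (n + 1) R = 0 := by
      ext i j
      simp only [padRows, Matrix.of_apply, Matrix.zero_apply]
      split_ifs
      · rw [Subsingleton.elim j 0, Subsingleton.elim (⟨_, _⟩ : Fin 1) 0, hR]
      · rfl
    exact ⟨_, reflection_mem_orthogonalGroup (transpose_mul_self_eq_one hw),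
      by simp [hx, hR0], h1, h2, h3⟩
  · set σ := sgn (x 0 0) with hσ
    have hσσ : σ * σ = 1 := sgn_mul_sgn _
    have hσx : σ * x 0 0 = |x 0 0| := sgn_mul_self _
    have hσ1 : |σ| = 1 := abs_sgn _
    have hrpos : 0 < r := by
      refine lt_of_le_of_ne hr0 fun hr => h0 ?_
      obtain ⟨δ, -, h⟩ := hs
      rw [h, ← hr, zero_mul]
    set u : Fin (n + 1) → ℝ := fun i => x i 0 + if i = 0 then σ * r else 0 with hu
    have hux : ∑ i, u i * x i 0 = r ^ 2 + |x 0 0| * r := by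
      simp only [hu, add_mul, Finset.sum_add_distrib, ite_mul, zero_mul, Finset.sum_ite_eq',
        Finset.mem_univ, if_true]
      rw [hr2, ← hσx]
      simp only [sq]
      ring
    -- Both sides equal `2 * (r ^ 2 + |x 0 0| * r)`; this is the condition for the reflection along
    -- `u` to send `x` to `-σ * r` times the first basis vector.
    have huu : ∑ i, u i ^ 2 = 2 * ∑ i, u i * x i 0 := by
      have e : ∑ i, u i ^ 2 = ∑ i, u i * x i 0 + ∑ i, u i * (if i = 0 then σ * r else 0) := by
        rw [← Finset.sum_add_distrib]
        refine Finset.sum_congr rfl fun i _ => ?_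
        rw [← mul_add, sq]
      rw [e, two_mul, hux]
      simp only [mul_ite, mul_zero, Finset.sum_ite_eq', Finset.mem_univ, if_true, hu]
      linear_combination r * hσx + r ^ 2 * hσσ
    set c := √(∑ i, u i ^ 2) with hc
    have huu_pos : 0 < ∑ i, u i ^ 2 := by
      rw [huu, hux]
      have := abs_nonneg (x 0 0)
      positivity
    have hcpos : 0 < c := Real.sqrt_pos.2 huu_pos
    have hc2 : c ^ 2 = ∑ i, u i ^ 2 := Real.sq_sqrt huu_pos.le
    have hv_round : ∀ i, FlRound (8 * τ) (u i) (v i) := by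
      intro i
      by_cases hi : i = 0
      · subst hi
        refine FlRound.trans (a := 6 * τ) (FlRound.of_abs_sub_le (by positivity) ?_) hv0
          (by nlinarith)
        -- The sign choice makes the two terms add up, so the error of `s`, relative to `r`, is no
        -- larger relative to `u 0`.
        have e : u 0 = σ * (|x 0 0| + r) := by
          simp only [hu, if_true, ← hσx]
          linear_combination (-x 0 0) * hσσ
        have e2 : x 0 0 + σ * s - u 0 = σ * (s - r) := by
          simp only [hu, if_true]
          ring
        rw [e2, e, abs_mul, abs_mul, hσ1, one_mul, one_mul,
          abs_of_nonneg (by positivity : 0 ≤ |x 0 0| + r)]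
        have h1 := hs.abs_sub_le
        rw [abs_of_nonneg hr0] at h1
        refine h1.trans ?_
        have := abs_nonneg (x 0 0)
        exact mul_le_mul_of_nonneg_left (by linarith) (by positivity)
      · have : v i = u i := by simp [hu, hi, hv i hi]
        rw [this]
        exact FlRound.refl (by positivity) _
    have hvsum : FlRound (17 * τ) (∑ i, u i ^ 2) (∑ i, v i ^ 2) :=
      FlRound.sum (by positivity) (fun i => sq_nonneg _) fun i => by
        rw [sq, sq]
        exact (hv_round i).mul (hv_round i) (by nlinarith)
    have hνc : FlRound (24 * τ) c ν :=
      (hvsum.sqrt huu_pos.le (by linarith)).trans (hν.flRound hε hn hN hNε)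
        (by nlinarith)
    set w : Matrix (Fin (n + 1)) (Fin 1) ℝ := Matrix.of fun i _ => u i / c with hw
    have hww : ∑ i, w i 0 ^ 2 = 1 := by
      simp only [hw, Matrix.of_apply, div_pow, ← Finset.sum_div, ← hc2]
      exact div_self (by positivity)
    -- The quotient contributes `2 * (8 + 24) = 64`; the rest covers the final rounding, as `τ ≤ 1 /
    -- 1000`.
    have hWr : ∀ i, FlRound (70 * τ) (w i 0) (W i 0) := fun i =>
      ((hv_round i).div hνc (c := 64 * τ) (by linarith) (by linarith)).trans (hW i) (by nlinarith)
    have hYr : ∀ i, FlRound (72 * τ) (2 * w i 0) (Y 0 i) := fun i =>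
      FlRound.trans (a := 70 * τ) (b := ε)
        (by simpa using (FlRound.refl (le_refl 0) (2 : ℝ)).mul (hWr i) (c := 70 * τ) (by linarith))
        (hY i) (by nlinarith)
    obtain ⟨h1, h2, h3⟩ := reflection_rounded hn hτ hNε hww hWr hYr
    refine ⟨_, reflection_mem_orthogonalGroup (transpose_mul_self_eq_one hww), ?_, h1, h2, h3⟩
    have hQx : ∀ i, ((1 - (2 : ℝ) • (w * w.transpose) : Matrix (Fin (n + 1)) (Fin (n + 1)) ℝ) * x)
        i 0 = x i 0 - u i := by
      intro i
      rw [← reflection_mul_column (fun i => x i 0) (fun i => w i 0) u i c (fun i => rfl) hcpos.ne'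
        (by rw [hc2, huu]), Matrix.sub_mul, Matrix.one_mul, Matrix.smul_mul, Matrix.sub_apply,
        Matrix.smul_apply, smul_eq_mul, Matrix.mul_apply]
      simp [Matrix.mul_apply]
    have hentry : ∀ i j, |((1 - (2 : ℝ) • (w * w.transpose) :
        Matrix (Fin (n + 1)) (Fin (n + 1)) ℝ) * x - padRows (n + 1) R) i j| ≤ 6 * τ * r := by
      intro i j
      rw [Subsingleton.elim j 0, Matrix.sub_apply, hQx]
      by_cases hi : i = 0
      · subst hi
        have e : x 0 0 - u 0 - padRows (n + 1) R 0 0 = σ * (s - r) := by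
          have : padRows (n + 1) R 0 0 = R 0 0 := by simp [padRows]
          rw [this, hR]
          simp only [hu, if_true]
          ring
        rw [e, abs_mul, hσ1, one_mul]
        have h1 := hs.abs_sub_le
        rwa [abs_of_nonneg hr0] at h1
      · have e : x i 0 - u i - padRows (n + 1) R i 0 = 0 := by
          simp [hu, hi, padRows]
        rw [e, abs_zero]
        positivity
    refine (norm_le_of_abs_entry_le hn hN _ (by positivity) hentry).trans ?_
    have hrx : r ≤ ‖x‖ := sqrt_sum_sq_le_norm x
    calc (N : ℝ) * (6 * τ * r) ≤ N * (300 * τ * ‖x‖) := by gcongr; norm_num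
      _ = 300 * N * τ * ‖x‖ := by ring

/-! ### The recursive QR decomposition -/

/-- Products of matrices with dimensions at most `N` are computed with relative error `M * ε`. -/
def MulError (mm : SquareMul) (ε M : ℝ) (N : ℕ) : Prop :=
  ∀ p q r : ℕ, p ≤ N → q ≤ N → r ≤ N → ∀ (A : Matrix (Fin p) (Fin q) ℝ)
    (B : Matrix (Fin q) (Fin r) ℝ) (D : Matrix (Fin p) (Fin r) ℝ), FlMul mm ε A B D →
    ‖D - A * B‖ ≤ M * ε * (‖A‖ * ‖B‖)

/-- Shared by steps (b) and (d). The outer product contributes `3 * 6 = 18`, since `‖S‖ ≤ 6 * N *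
‖B‖`, and the inner error propagated through `W` contributes `9`. -/
theorem MulError.norm_mul_mul_sub_le {mm : SquareMul} {ε M : ℝ} {N : ℕ} (h : MulError mm ε M N)
    (hε : 0 ≤ ε) (hM : 0 ≤ M) (hMε : M * ε ≤ 1) {n k q l : ℕ} (hn : n ≤ N) (hk : k ≤ N)
    (hq : q ≤ N) (hl : l ≤ N) {W : Matrix (Fin n) (Fin k) ℝ} {Y : Matrix (Fin k) (Fin q) ℝ}
    {B : Matrix (Fin q) (Fin l) ℝ} {S : Matrix (Fin k) (Fin l) ℝ} {T : Matrix (Fin n) (Fin l) ℝ}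
    (hW : ‖W‖ ≤ 3 * N) (hY : ‖Y‖ ≤ 3 * N) (hS : FlMul mm ε Y B S) (hT : FlMul mm ε W S T) :
    ‖T - W * (Y * B)‖ ≤ 27 * M * N ^ 2 * ε * ‖B‖ ∧ ‖T‖ ≤ 36 * N ^ 2 * ‖B‖ := by
  have hB := norm_nonneg B
  have h1 : ‖S - Y * B‖ ≤ M * ε * (3 * N * ‖B‖) := (h _ _ _ hk hq hl _ _ _ hS).trans (by gcongr)
  have h2 : ‖Y * B‖ ≤ 3 * N * ‖B‖ :=
    (Matrix.l2_opNorm_mul _ _).trans (mul_le_mul_of_nonneg_right hY hB)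
  have h3 : ‖S‖ ≤ 6 * N * ‖B‖ := by
    have h4 : M * ε * (3 * N * ‖B‖) ≤ 1 * (3 * N * ‖B‖) :=
      mul_le_mul_of_nonneg_right hMε (by positivity)
    have h5 := norm_le_norm_add_norm_sub (Y * B) S
    rw [norm_sub_rev] at h5
    linarith
  have h4 : ‖T - W * S‖ ≤ M * ε * (3 * N * (6 * N * ‖B‖)) :=
    (h _ _ _ hn hk hl _ _ _ hT).trans (by gcongr)
  have h5 : ‖W * (S - Y * B)‖ ≤ 3 * N * (M * ε * (3 * N * ‖B‖)) :=
    (Matrix.l2_opNorm_mul _ _).trans (mul_le_mul hW h1 (norm_nonneg _) (by positivity))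
  have h6 : ‖W * (Y * B)‖ ≤ 3 * N * (3 * N * ‖B‖) :=
    (Matrix.l2_opNorm_mul _ _).trans (mul_le_mul hW h2 (norm_nonneg _) (by positivity))
  have h7 : ‖T - W * (Y * B)‖ ≤ 27 * M * N ^ 2 * ε * ‖B‖ := by
    have e : T - W * (Y * B) = (T - W * S) + W * (S - Y * B) := by
      rw [Matrix.mul_sub]; abel
    rw [e]
    refine (norm_add_le _ _).trans ((add_le_add h4 h5).trans (le_of_eq ?_))
    ring
  refine ⟨h7, ?_⟩
  have h8 : 27 * M * N ^ 2 * ε * ‖B‖ ≤ 27 * N ^ 2 * ‖B‖ := by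
    calc 27 * M * N ^ 2 * ε * ‖B‖ = (M * ε) * (27 * N ^ 2 * ‖B‖) := by ring
      _ ≤ 1 * (27 * N ^ 2 * ‖B‖) := mul_le_mul_of_nonneg_right hMε (by positivity)
      _ = _ := one_mul _
  have h9 := norm_le_norm_add_norm_sub (W * (Y * B)) T
  rw [norm_sub_rev] at h9
  nlinarith

theorem FlSub.norm_update_le {ε M : ℝ} {N : ℕ} (hN : 1 ≤ N) (hε : 0 ≤ ε) (hM : 1 ≤ M)
    {n l : ℕ} (hn : n ≤ N) (hl : l ≤ N) {B T Z C : Matrix (Fin n) (Fin l) ℝ}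
    (hT : ‖T‖ ≤ 36 * N ^ 2 * ‖B‖) (hTZ : ‖T - Z‖ ≤ 27 * M * N ^ 2 * ε * ‖B‖)
    (h : FlSub ε B T C) : ‖C - (B - Z)‖ ≤ 64 * M * N ^ 3 * ε * ‖B‖ := by
  have hN' : (1 : ℝ) ≤ N := by exact_mod_cast hN
  have hB := norm_nonneg B
  have h1 : ‖B - T‖ ≤ 37 * N ^ 2 * ‖B‖ := by
    have h2 : 1 * ‖B‖ ≤ N ^ 2 * ‖B‖ := mul_le_mul_of_nonneg_right (one_le_pow₀ hN') hB
    have := _root_.norm_sub_le B T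
    linarith
  have h2 : ‖C - (B - T)‖ ≤ N * ε * (37 * N ^ 2 * ‖B‖) :=
    (h.norm_sub_le hn hl hε).trans (by gcongr)
  have e : C - (B - Z) = (C - (B - T)) - (T - Z) := by abel
  rw [e]
  refine (_root_.norm_sub_le _ _).trans ((add_le_add h2 hTZ).trans ?_)
  have h3 : N * ε * (37 * N ^ 2 * ‖B‖) ≤ 37 * M * N ^ 3 * ε * ‖B‖ := by
    have : 37 * (1 * (N ^ 3 * ε * ‖B‖)) ≤ 37 * (M * (N ^ 3 * ε * ‖B‖)) := by gcongr
    linarith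
  have h4 : 27 * M * N ^ 2 * ε * ‖B‖ ≤ 27 * M * N ^ 3 * ε * ‖B‖ := by
    have : (N : ℝ) ^ 2 ≤ N ^ 3 := pow_le_pow_right₀ hN' (by norm_num)
    gcongr
  linarith

theorem hcat_zero_mul {k p l q : ℕ} (Y : Matrix (Fin l) (Fin p) ℝ)
    (W : Matrix (Fin (k + p)) (Fin q) ℝ) :
    hcat (0 : Matrix (Fin l) (Fin k) ℝ) Y * W = Y * W.submatrix (Fin.natAdd k) id := by
  ext i j
  simp [Matrix.mul_apply, Fin.sum_univ_add]

/-- Backward stability of one run of the recursive QR decomposition: `Q` is an orthogonal matrix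
close to `1 - W * Y`, and `Q * A` is close to `[R; 0]`. -/
def QRRBound (D D₂ ε : ℝ) {n m : ℕ} (A : Matrix (Fin n) (Fin m) ℝ) (R : Matrix (Fin m) (Fin m) ℝ)
    (W : Matrix (Fin n) (Fin m) ℝ) (Y : Matrix (Fin m) (Fin n) ℝ) : Prop :=
  ‖W‖ ≤ 3 * m - 1 ∧ ‖Y‖ ≤ 3 * m ∧ ∃ Q ∈ Matrix.orthogonalGroup (Fin n) ℝ,
    ‖Q * A - padRows n R‖ ≤ (2 * m - 1) * D₂ * ε * ‖A‖ ∧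
    ‖1 - W * Y - Q‖ ≤ (2 * m - 1) * D * ε

/-- With `EX` the error in `X`, the new factor is `(1 - P) * (1 - W * Y) - EX * Y`. Expanding the
product around `Q' * Q` leaves each defect once, times an orthogonal matrix, plus their product. -/
theorem norm_compact_sub_le {n k : ℕ} {b b' e y : ℝ}
    {W X EX : Matrix (Fin n) (Fin k) ℝ} {Y : Matrix (Fin k) (Fin n) ℝ}
    {P Q Q' : Matrix (Fin n) (Fin n) ℝ} (hX : EX = X - (W - P * W))
    (hQ : Q ∈ Matrix.orthogonalGroup (Fin n) ℝ) (hQ' : Q' ∈ Matrix.orthogonalGroup (Fin n) ℝ)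
    (h : ‖1 - W * Y - Q‖ ≤ b) (h' : ‖1 - P - Q'‖ ≤ b') (hEX : ‖EX‖ ≤ e) (hY : ‖Y‖ ≤ y)
    (he : 0 ≤ e) :
    ‖1 - (X * Y + P) - Q' * Q‖ ≤ b' * b + b' + b + e * y := by
  have h1 : EX * Y = X * Y - (W * Y - P * (W * Y)) := by
    rw [hX, Matrix.sub_mul, Matrix.sub_mul, Matrix.mul_assoc]
  have key : 1 - (X * Y + P) - Q' * Q = (1 - P - Q') * (1 - W * Y - Q) + (1 - P - Q') * Q
      + Q' * (1 - W * Y - Q) - EX * Y := by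
    rw [h1]
    noncomm_ring
  rw [key]
  have e1 : ‖(1 - P - Q') * (1 - W * Y - Q)‖ ≤ b' * b :=
    (Matrix.l2_opNorm_mul _ _).trans
      (mul_le_mul h' h (norm_nonneg _) ((norm_nonneg _).trans h'))
  have e2 : ‖(1 - P - Q') * Q‖ ≤ b' :=
    ((Matrix.l2_opNorm_mul _ _).trans
      (mul_le_of_le_one_right (norm_nonneg _) (norm_orthogonal_le hQ))).trans h'
  have e3 : ‖Q' * (1 - W * Y - Q)‖ ≤ b := (norm_orthogonal_mul_le hQ' _).trans h
  have e4 : ‖EX * Y‖ ≤ e * y :=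
    (Matrix.l2_opNorm_mul _ _).trans (mul_le_mul hEX hY (norm_nonneg _) he)
  refine (norm_sub_le _ _).trans (add_le_add ((norm_add_le _ _).trans
    (add_le_add ((norm_add_le _ _).trans (add_le_add e1 e2)) e3)) e4)

/-- `X` is `Q' * W` up to small errors, so the bound has leading coefficient `1` on `‖W‖`; the plain
triangle inequality would let norms grow geometrically with the depth. -/
theorem norm_compact_left_le {n k : ℕ} {b' e : ℝ} {W X EX : Matrix (Fin n) (Fin k) ℝ}
    {P Q' : Matrix (Fin n) (Fin n) ℝ} (hX : EX = X - (W - P * W))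
    (hQ' : Q' ∈ Matrix.orthogonalGroup (Fin n) ℝ) (h' : ‖1 - P - Q'‖ ≤ b') (hEX : ‖EX‖ ≤ e) :
    ‖X‖ ≤ ‖W‖ + b' * ‖W‖ + e := by
  have key : X = Q' * W + (1 - P - Q') * W + EX := by
    rw [hX, Matrix.sub_mul, Matrix.sub_mul, Matrix.one_mul]
    abel
  rw [key]
  refine (norm_add_le _ _).trans (add_le_add ((norm_add_le _ _).trans
    (add_le_add (norm_orthogonal_mul_le hQ' _) ?_)) hEX)
  exact (Matrix.l2_opNorm_mul _ _).trans (mul_le_mul_of_nonneg_right h' (norm_nonneg _))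

/-- The factor `diag(1, Q')` fixes the finished block `[RL; 0]`, so the left residual is only
rotated. On the right, the error of the update is rotated and the residual of `A22` added, with
`‖A22‖` at most `1 + (b + g)` times `‖AR‖`. -/
theorem norm_oneDiag_mul_hcat_sub_le {k l p : ℕ} {a b a' g : ℝ} (ha' : 0 ≤ a')
    {Q WY : Matrix (Fin (k + p)) (Fin (k + p)) ℝ} {Q' : Matrix (Fin p) (Fin p) ℝ}
    (hQ : Q ∈ Matrix.orthogonalGroup (Fin (k + p)) ℝ) (hQ' : Q' ∈ Matrix.orthogonalGroup (Fin p) ℝ)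
    {AL : Matrix (Fin (k + p)) (Fin k) ℝ} {AR : Matrix (Fin (k + p)) (Fin l) ℝ}
    {RL : Matrix (Fin k) (Fin k) ℝ} {A12 : Matrix (Fin k) (Fin l) ℝ}
    {A22 : Matrix (Fin p) (Fin l) ℝ} {RR : Matrix (Fin l) (Fin l) ℝ}
    (hL : ‖Q * AL - padRows (k + p) RL‖ ≤ a * ‖AL‖) (hR : ‖Q' * A22 - padRows p RR‖ ≤ a' * ‖A22‖)
    (hWY : ‖1 - WY - Q‖ ≤ b) (hA : ‖vcat A12 A22 - (AR - WY * AR)‖ ≤ g * ‖AR‖) (ha : 0 ≤ a)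
    (hb : 0 ≤ b) (hg : 0 ≤ g) :
    ‖oneDiag k Q' * Q * hcat AL AR - padRows (k + p) (vcat (hcat RL A12) (hcat 0 RR))‖
      ≤ (a + (b + g) + a' * (1 + (b + g))) * ‖hcat AL AR‖ := by
  have hD := oneDiag_mem_orthogonalGroup k hQ'
  have hAL := norm_le_hcat_left AL AR
  have hAR := norm_le_hcat_right AL AR
  have h1 : ‖Q * AR - vcat A12 A22‖ ≤ (b + g) * ‖AR‖ := by
    have e : Q * AR - vcat A12 A22
        = -((1 - WY - Q) * AR) - (vcat A12 A22 - (AR - WY * AR)) := by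
      rw [Matrix.sub_mul, Matrix.sub_mul, Matrix.one_mul]
      abel
    rw [e, add_mul]
    refine (norm_sub_le _ _).trans (add_le_add ?_ hA)
    rw [norm_neg]
    exact (Matrix.l2_opNorm_mul _ _).trans (mul_le_mul_of_nonneg_right hWY (norm_nonneg _))
  have h2 : ‖A22‖ ≤ (1 + (b + g)) * ‖AR‖ := by
    refine (norm_le_vcat_right A12 A22).trans ?_
    have := norm_le_norm_add_norm_sub (Q * AR) (vcat A12 A22)
    rw [add_mul, one_mul]
    exact this.trans (add_le_add (norm_orthogonal_mul_le hQ AR) h1)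
  have key : oneDiag k Q' * Q * hcat AL AR - padRows (k + p) (vcat (hcat RL A12) (hcat 0 RR))
      = hcat (oneDiag k Q' * (Q * AL - padRows (k + p) RL))
          (oneDiag k Q' * (Q * AR - vcat A12 A22) + vcat 0 (Q' * A22 - padRows p RR)) := by
    have e1 : vcat (0 : Matrix (Fin k) (Fin l) ℝ) (Q' * A22 - padRows p RR)
        = vcat A12 (Q' * A22) - vcat A12 (padRows p RR) := by rw [vcat_sub, sub_self]
    have e2 : oneDiag k Q' * padRows (k + p) RL = vcat RL 0 := by
      rw [padRows_add, oneDiag_mul_vcat, Matrix.mul_zero]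
    rw [padRows_block, mul_hcat, hcat_sub, e1, Matrix.mul_sub, e2, Matrix.mul_sub,
      oneDiag_mul_vcat, Matrix.mul_assoc, Matrix.mul_assoc]
    congr 1
    abel
  rw [key]
  have h3 : ‖oneDiag k Q' * (Q * AL - padRows (k + p) RL)‖ ≤ a * ‖hcat AL AR‖ :=
    ((norm_orthogonal_mul_le hD _).trans hL).trans (mul_le_mul_of_nonneg_left hAL ha)
  have h4 : ‖oneDiag k Q' * (Q * AR - vcat A12 A22)‖ ≤ (b + g) * ‖hcat AL AR‖ :=
    ((norm_orthogonal_mul_le hD _).trans h1).trans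
      (mul_le_mul_of_nonneg_left hAR (by positivity))
  have h5 : ‖vcat (0 : Matrix (Fin k) (Fin l) ℝ) (Q' * A22 - padRows p RR)‖
      ≤ a' * (1 + (b + g)) * ‖hcat AL AR‖ := by
    refine (norm_vcat_zero_le _).trans (hR.trans ?_)
    rw [mul_assoc]
    refine mul_le_mul_of_nonneg_left (h2.trans ?_) ha'
    exact mul_le_mul_of_nonneg_left hAR (by positivity)
  refine (norm_hcat_le _ _).trans ((add_le_add h3 ((norm_add_le _ _).trans
    (add_le_add h4 h5))).trans (le_of_eq ?_))
  ring

-- `G * ε` bounds one update, `D` adds its amplification by `‖Y‖`, and `D₂` is larger by `4 * N`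
-- because each residual also inherits the accumulated orthogonality defect. Hypothesis `hS` makes
-- all second order terms fit into the spare unit.
set_option maxHeartbeats 1000000 in
theorem FlQRR.qrrBound {mm : SquareMul} {ε M G D D₂ : ℝ} {N : ℕ} (hmul : MulError mm ε M N)
    (hε : 0 ≤ ε) (hN : 1 ≤ N) (hNε : (N : ℝ) * ε ≤ 1 / 1000) (hM : 300 * (N : ℝ) ^ 2 ≤ M)
    (hG : G = 64 * M * N ^ 3) (hD : D = 9 * N ^ 2 * G + 1) (hD₂ : D₂ = 4 * N * D)
    (hS : 24 * N ^ 2 * D ^ 2 * ε ≤ 1) {n m : ℕ} {A : Matrix (Fin n) (Fin m) ℝ}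
    {R : Matrix (Fin m) (Fin m) ℝ} {W : Matrix (Fin n) (Fin m) ℝ} {Y : Matrix (Fin m) (Fin n) ℝ}
    (h : FlQRR mm ε n m A R W Y) (hn : n ≤ N) (hm : m ≤ N) :
    0 < m ∧ QRRBound D D₂ ε A R W Y := by
  have hN' : (1 : ℝ) ≤ N := by exact_mod_cast hN
  have hN2 : (1 : ℝ) ≤ N ^ 2 := one_le_pow₀ hN'
  have hN3 : (1 : ℝ) ≤ N ^ 3 := one_le_pow₀ hN'
  have hM1 : 1 ≤ M := by linarith
  have hMG : M ≤ G := by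
    rw [hG]
    have := le_mul_of_one_le_right (by linarith : 0 ≤ M) hN3
    linarith
  have hG0 : 0 ≤ G := by linarith
  have hNG : G ≤ N ^ 2 * G := le_mul_of_one_le_left hG0 hN2
  have hGD : 9 * G + 1 ≤ D := by linarith
  have hD1 : 1 ≤ D := by linarith
  have hDD : D ≤ D ^ 2 := by nlinarith
  have hND : D ^ 2 ≤ N ^ 2 * D ^ 2 := le_mul_of_one_le_left (by positivity) hN2
  have hNDε : N ^ 2 * D * ε ≤ N ^ 2 * D ^ 2 * ε := by gcongr
  have hMD : M * ε ≤ N ^ 2 * D ^ 2 * ε := by gcongr; linarith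
  have hMε : M * ε ≤ 1 := by nlinarith
  have hDD₂ : D ≤ D₂ := by rw [hD₂]; nlinarith
  induction h with
  | @column n x R W Y h =>
    refine ⟨one_pos, ?_⟩
    obtain ⟨Q, hQ, h1, h2, h3, h4⟩ := h.exists_orthogonal hε hn hNε
    have hMε' : 300 * (N : ℝ) ^ 2 * ε ≤ M * ε := mul_le_mul_of_nonneg_right hM hε
    refine ⟨?_, ?_, Q, hQ, h1.trans ?_, h2.trans ?_⟩
    · push_cast; linarith
    · push_cast; linarith
    · refine mul_le_mul_of_nonneg_right (hMε'.trans ?_) (norm_nonneg _)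
      refine mul_le_mul_of_nonneg_right ?_ hε
      push_cast
      linarith
    · refine hMε'.trans (mul_le_mul_of_nonneg_right ?_ hε)
      push_cast
      linarith
  | @split k l p hk hkl hlp AL AR RL WL YL hL S T A12 A22 hS1 hT1 hA RR WR YR hR S' T' X hS2 hT2
      hX ihL ihR =>
    refine ⟨by omega, ?_⟩
    obtain ⟨-, hWL, hYL, QL, hQL, hL1, hL2⟩ := ihL hn (by omega)
    obtain ⟨hl, hWR, hYR, QR, hQR, hR1, hR2⟩ := ihR (by omega) (by omega)
    have hk1 : (1 : ℝ) ≤ k := by exact_mod_cast hk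
    have hl1 : (1 : ℝ) ≤ l := by exact_mod_cast hl
    have hklN : (k : ℝ) + l ≤ N := by exact_mod_cast hm
    have hupd : ‖vcat A12 A22 - (AR - WL * (YL * AR))‖ ≤ G * ε * ‖AR‖ := by
      obtain ⟨h1, h2⟩ := hmul.norm_mul_mul_sub_le hε (by linarith) hMε hn (by omega) hn (by omega)
        (hWL.trans (by linarith)) (hYL.trans (by linarith)) hS1 hT1
      rw [hG]
      exact hA.norm_update_le hN hε hM1 hn (by omega) h2 h1
    rw [← Matrix.mul_assoc] at hupd
    set E := vcat (0 : Matrix (Fin k) (Fin l) ℝ) WR with hE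
    set F := hcat (0 : Matrix (Fin l) (Fin k) ℝ) YR with hF
    -- Padded with zeros, step (d) has the shape of the update (b), with `WL` in the role of `AR`,
    -- so the same estimate applies.
    set EX := X - (WL - E * F * WL) with hEX
    have hEXn : ‖EX‖ ≤ G * ε * (3 * N) := by
      obtain ⟨h1, h2⟩ := hmul.norm_mul_mul_sub_le hε (by linarith) hMε (by omega) (by omega)
        (by omega) (by omega) (hWR.trans (by linarith)) (hYR.trans (by linarith)) hS2 hT2
      have hsub := norm_rows_le WL (Fin.natAdd_injective p k)
      have e : E * F * WL = vcat 0 (WR * (YR * WL.submatrix (Fin.natAdd k) id)) := by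
        rw [Matrix.mul_assoc, hF, hcat_zero_mul, hE, vcat_mul, Matrix.zero_mul]
      have h3 : ‖EX‖ ≤ G * ε * ‖WL‖ := by
        rw [hEX, e, hG]
        refine hX.norm_update_le hN hε hM1 hn (by omega) ?_ ?_
        · exact (norm_vcat_zero_le _).trans (h2.trans (by gcongr))
        · rw [vcat_sub, sub_self]
          exact (norm_vcat_zero_le _).trans (h1.trans (by gcongr))
      exact h3.trans (mul_le_mul_of_nonneg_left (by linarith) (by positivity))
    have hP : ‖1 - E * F - oneDiag k QR‖ ≤ (2 * l - 1) * D * ε := by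
      rw [hE, hF, one_sub_vcat_mul_hcat]
      exact (norm_oneDiag_sub_le _ _).trans hR2
    have hDR := oneDiag_mem_orthogonalGroup k hQR
    have hbL0 : 0 ≤ (2 * (k : ℝ) - 1) * D * ε := (norm_nonneg _).trans hL2
    have hbR0 : 0 ≤ (2 * (l : ℝ) - 1) * D * ε := (norm_nonneg _).trans hR2
    have hbL : (2 * (k : ℝ) - 1) * D * ε ≤ 2 * N * D * ε := by gcongr; linarith
    have hbR : (2 * (l : ℝ) - 1) * D * ε ≤ 2 * N * D * ε := by gcongr; linarith
    have hWLN : ‖WL‖ ≤ 3 * N := hWL.trans (by linarith)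
    refine ⟨?_, ?_, oneDiag k QR * QL, mul_mem hDR hQL, ?_, ?_⟩
    -- The extra terms total at most `7 * N ^ 2 * D * ε ≤ 1`; one of the two `-1`'s of the halves
    -- pays for them.
    · have h1 := norm_compact_left_le hEX hDR hP hEXn
      have h2 : (2 * (l : ℝ) - 1) * D * ε * ‖WL‖ ≤ 2 * N * D * ε * (3 * N) :=
        mul_le_mul hbR hWLN (norm_nonneg _) (by positivity)
      have h3 : G * ε * (3 * N) ≤ N ^ 2 * D * ε := by
        have h4 : G * N ≤ G * N ^ 2 := mul_le_mul_of_nonneg_left (le_self_pow₀ hN' two_ne_zero) hG0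
        have h5 : D ≤ N ^ 2 * D := le_mul_of_one_le_left (by linarith) hN2
        calc G * ε * (3 * N) = 3 * (G * N) * ε := by ring
          _ ≤ N ^ 2 * D * ε := mul_le_mul_of_nonneg_right (by nlinarith) hε
      have h6 := norm_hcat_le X E
      have h7 : ‖E‖ ≤ ‖WR‖ := norm_vcat_zero_le WR
      push_cast
      linarith
    · refine (norm_vcat_le YL F).trans ?_
      have h1 : ‖F‖ ≤ ‖YR‖ := norm_hcat_zero_le YR
      push_cast
      linarith
    · have haL : (2 * (k : ℝ) - 1) * D₂ * ε ≥ 0 :=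
        mul_nonneg (mul_nonneg (by linarith) (by linarith)) hε
      have haR : (2 * (l : ℝ) - 1) * D₂ * ε ≥ 0 :=
        mul_nonneg (mul_nonneg (by linarith) (by linarith)) hε
      refine (norm_oneDiag_mul_hcat_sub_le haR hQL hQR hL1 hR1 hL2 hupd haL hbL0
        (by positivity)).trans (mul_le_mul_of_nonneg_right ?_ (norm_nonneg _))
      have hη : (2 * (k : ℝ) - 1) * D * ε + G * ε ≤ 3 * N * D * ε := by
        have h1 : G * ε ≤ N * D * ε := by
          have h0 : D ≤ N * D := le_mul_of_one_le_left (by linarith) hN'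
          exact mul_le_mul_of_nonneg_right (by linarith) hε
        linarith
      have haR' : (2 * (l : ℝ) - 1) * D₂ * ε ≤ 2 * N * D₂ * ε := by
        have : 0 ≤ D₂ := by linarith
        gcongr
        linarith
      set η := (2 * (k : ℝ) - 1) * D * ε + G * ε
      have hη0 : 0 ≤ η := by positivity
      have h2 : (2 * (l : ℝ) - 1) * D₂ * ε * η ≤ 2 * N * D₂ * ε * (3 * N * D * ε) :=
        mul_le_mul haR' hη hη0 (by rw [hD₂]; positivity)
      -- The spare unit `D₂ * ε = 4 * N * D * ε` splits as `3` for the update and `1` for this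
      -- second order term.
      have h3 : 2 * N * D₂ * ε * (3 * N * D * ε) ≤ N * D * ε := by
        have e : 2 * N * D₂ * ε * (3 * N * D * ε) = (24 * N ^ 2 * D ^ 2 * ε) * (N * ε) := by
          rw [hD₂]; ring
        have h4 : N * ε * 1 ≤ N * ε * D := mul_le_mul_of_nonneg_left hD1 (by positivity)
        rw [e]
        refine (mul_le_mul_of_nonneg_right hS (by positivity)).trans ?_
        linarith
      have h5 : D₂ * ε = 4 * N * D * ε := by rw [hD₂]
      push_cast
      linarith
    · rw [hcat_mul_vcat]
      refine (norm_compact_sub_le hEX hQL hDR hL2 hP hEXn (hYL.trans (by linarith : _ ≤ 3 * (N : ℝ)))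
        (by positivity)).trans ?_
      have h1 : (2 * (l : ℝ) - 1) * D * ε * ((2 * k - 1) * D * ε) ≤ 2 * N * D * ε * (2 * N * D * ε) :=
        mul_le_mul hbR hbL hbL0 (by positivity)
      have h2 : 2 * N * D * ε * (2 * N * D * ε) ≤ 1 * ε := by
        have : 2 * N * D * ε * (2 * N * D * ε) = 4 * N ^ 2 * D ^ 2 * ε * ε := by ring
        rw [this]
        exact mul_le_mul_of_nonneg_right (by linarith [show 0 ≤ N ^ 2 * D ^ 2 * ε by positivity]) hε
      -- This dictates the choice of `D`: the error in `X` times `‖Y‖`, plus the product of the two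
      -- defects, is one unit.
      have h3 : G * ε * (3 * N) * (3 * N) + 1 * ε = D * ε := by rw [hD]; ring
      push_cast
      linarith

/-! ### Explicit orthogonal factors and the URV decomposition -/

theorem FlQR.exists_orthogonal {mm : SquareMul} {ε M G D D₂ : ℝ} {N : ℕ}
    (hmul : MulError mm ε M N) (hε : 0 ≤ ε) (hN : 1 ≤ N) (hNε : (N : ℝ) * ε ≤ 1 / 1000)
    (hM : 300 * (N : ℝ) ^ 2 ≤ M) (hG : G = 64 * M * N ^ 3) (hD : D = 9 * N ^ 2 * G + 1)
    (hD₂ : D₂ = 4 * N * D) (hS : 24 * N ^ 2 * D ^ 2 * ε ≤ 1) (hMε : M * ε ≤ 1)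
    {A Q R : Matrix (Fin N) (Fin N) ℝ} (h : FlQR mm ε A Q R) :
    ∃ H ∈ Matrix.orthogonalGroup (Fin N) ℝ, ‖Q - H‖ ≤ D₂ * ε ∧
      ‖H.transpose * A - R‖ ≤ 2 * N * D₂ * ε * ‖A‖ := by
  obtain ⟨W, Y, P, hQRR, hP, hQ⟩ := h
  obtain ⟨-, hW, hY, H, hH, h1, h2⟩ :=
    hQRR.qrrBound hmul hε hN hNε hM hG hD hD₂ hS le_rfl le_rfl
  have hN' : (1 : ℝ) ≤ N := by exact_mod_cast hN
  have hN2 : (1 : ℝ) ≤ N ^ 2 := one_le_pow₀ hN'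
  have hM1 : 1 ≤ M := by linarith
  have hG0 : 0 ≤ G := by rw [hG]; positivity
  have hD0 : 0 ≤ D := by rw [hD]; positivity
  have hD₂0 : 0 ≤ D₂ := by rw [hD₂]; positivity
  have hWY : ‖W‖ * ‖Y‖ ≤ 9 * N ^ 2 := by
    calc ‖W‖ * ‖Y‖ ≤ (3 * N) * (3 * N) :=
          mul_le_mul (by linarith) hY (norm_nonneg _) (by positivity)
      _ = 9 * N ^ 2 := by ring
  have h3 : ‖P - W * Y‖ ≤ M * ε * (9 * N ^ 2) :=
    (hmul _ _ _ le_rfl le_rfl le_rfl _ _ _ hP).trans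
      (mul_le_mul_of_nonneg_left hWY (by positivity))
  have h4 : ‖P‖ ≤ 18 * N ^ 2 := by
    have h5 : M * ε * (9 * N ^ 2) ≤ 1 * (9 * N ^ 2) :=
      mul_le_mul_of_nonneg_right hMε (by positivity)
    have h6 := norm_le_norm_add_norm_sub (W * Y) P
    have h7 := (Matrix.l2_opNorm_mul W Y).trans hWY
    rw [norm_sub_rev] at h6
    linarith
  have h5 : ‖Q.transpose - (1 - P)‖ ≤ N * ε * (19 * N ^ 2) := by
    refine (hQ.norm_sub_le le_rfl le_rfl hε).trans (mul_le_mul_of_nonneg_left ?_ (by positivity))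
    have := norm_one_le (Fin N)
    have := norm_sub_le (1 : Matrix (Fin N) (Fin N) ℝ) P
    linarith
  refine ⟨H.transpose, transpose_mem_orthogonalGroup hH, ?_, ?_⟩
  · rw [← norm_transpose, Matrix.transpose_sub, Matrix.transpose_transpose]
    have e : Q.transpose - H = (Q.transpose - (1 - P)) - (P - W * Y) + (1 - W * Y - H) := by abel
    rw [e]
    refine (norm_add_le _ _).trans ((add_le_add ((norm_sub_le _ _).trans (add_le_add h5 h3))
      h2).trans ?_)
    -- Forming `Q` explicitly costs at most `N * D * ε`; with the defect below `2 * N * D * ε` this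
    -- stays within `D₂ * ε = 4 * N * D * ε`.
    have h6 : 19 * (N : ℝ) ^ 3 + 9 * M * N ^ 2 ≤ N * D := by
      have e1 : (N : ℝ) ^ 3 ≤ M * N ^ 3 := le_mul_of_one_le_left (by positivity) hM1
      have e2 : M * (N : ℝ) ^ 2 ≤ M * N ^ 3 :=
        mul_le_mul_of_nonneg_left (pow_le_pow_right₀ hN' (by norm_num)) (by positivity)
      have e3 : D ≤ N * D := le_mul_of_one_le_left hD0 hN'
      have e4 : G ≤ N ^ 2 * G := le_mul_of_one_le_left hG0 hN2
      have e5 : 0 ≤ M * (N : ℝ) ^ 3 := by positivity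
      linarith
    have h7 : N * D * ε ≤ 2 * N * D * ε := by
      have : 0 ≤ N * D * ε := by positivity
      linarith
    have h8 := mul_le_mul_of_nonneg_right h6 hε
    have h9 : 0 ≤ D * ε := by positivity
    rw [hD₂]
    linarith
  · rw [Matrix.transpose_transpose]
    rw [padRows_self] at h1
    refine h1.trans ?_
    have h9 : 0 ≤ D₂ * ε * ‖A‖ := by positivity
    linarith

theorem FlRURV.exists_orthogonal {mm : SquareMul} {ε M G D D₂ : ℝ} {N : ℕ}
    (hmul : MulError mm ε M N) (hε : 0 ≤ ε) (hN : 1 ≤ N) (hNε : (N : ℝ) * ε ≤ 1 / 1000)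
    (hM : 300 * (N : ℝ) ^ 2 ≤ M) (hG : G = 64 * M * N ^ 3) (hD : D = 9 * N ^ 2 * G + 1)
    (hD₂ : D₂ = 4 * N * D) (hS : 24 * N ^ 2 * D ^ 2 * ε ≤ 1) (hMε : M * ε ≤ 1)
    (hDε : D₂ * ε ≤ 1) {A B U R V : Matrix (Fin N) (Fin N) ℝ} (h : FlRURV mm ε A B U R V) :
    ∃ δA Uhat Vhat : Matrix (Fin N) (Fin N) ℝ,
      Uhat ∈ Matrix.orthogonalGroup (Fin N) ℝ ∧ Vhat ∈ Matrix.orthogonalGroup (Fin N) ℝ ∧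
      A + δA = Uhat * R * Vhat ∧ ‖δA‖ ≤ 11 * N * D₂ * ε * ‖A‖ ∧
      ‖U - Uhat‖ ≤ D₂ * ε ∧ ‖V - Vhat‖ ≤ D₂ * ε := by
  obtain ⟨R₀, Ahat, hV, hA, hU⟩ := h
  obtain ⟨V', hV', hV1, -⟩ :=
    hV.exists_orthogonal hmul hε hN hNε hM hG hD hD₂ hS hMε
  obtain ⟨U', hU', hU1, hU2⟩ :=
    hU.exists_orthogonal hmul hε hN hNε hM hG hD hD₂ hS hMε
  have hN' : (1 : ℝ) ≤ N := by exact_mod_cast hN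
  have hN2 : (1 : ℝ) ≤ N ^ 2 := one_le_pow₀ hN'
  have hM1 : 1 ≤ M := by linarith
  have hG0 : 0 ≤ G := by rw [hG]; positivity
  have hD0 : 0 ≤ D := by rw [hD]; positivity
  have hD₂0 : 0 ≤ D₂ := by rw [hD₂]; positivity
  have hMD₂ : M ≤ D₂ := by
    have e1 : M ≤ M * N ^ 3 := le_mul_of_one_le_right (by positivity) (one_le_pow₀ hN')
    have e2 : G ≤ N ^ 2 * G := le_mul_of_one_le_left hG0 hN2
    have e3 : D ≤ N * D := le_mul_of_one_le_left hD0 hN'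
    linarith
  have hVn : ‖V‖ ≤ 2 := by
    have h1 := norm_le_norm_add_norm_sub V' V
    rw [norm_sub_rev] at h1
    have := norm_orthogonal_le hV'
    linarith
  have h1 : ‖Ahat - A * V'.transpose‖ ≤ 3 * D₂ * ε * ‖A‖ := by
    have e : Ahat - A * V'.transpose
        = (Ahat - A * V.transpose) + A * (V - V').transpose := by
      rw [Matrix.transpose_sub, mul_sub]
      abel
    have e1 : ‖Ahat - A * V.transpose‖ ≤ M * ε * (‖A‖ * 2) := by
      refine (hmul _ _ _ le_rfl le_rfl le_rfl _ _ _ hA).trans ?_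
      rw [norm_transpose]
      gcongr
    have e2 : ‖A * (V - V').transpose‖ ≤ ‖A‖ * (D₂ * ε) := by
      refine (Matrix.l2_opNorm_mul _ _).trans ?_
      rw [norm_transpose]
      gcongr
    have e3 : M * ε * (‖A‖ * 2) ≤ D₂ * ε * (‖A‖ * 2) := by gcongr
    rw [e]
    refine (norm_add_le _ _).trans ((add_le_add (e1.trans e3) e2).trans (le_of_eq ?_))
    ring
  have h2 : ‖Ahat‖ ≤ 4 * ‖A‖ := by
    have e1 : ‖Ahat - A * V.transpose‖ ≤ 1 * (‖A‖ * ‖V.transpose‖) :=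
      (hmul _ _ _ le_rfl le_rfl le_rfl _ _ _ hA).trans
        (mul_le_mul_of_nonneg_right hMε (by positivity))
    have e2 : ‖A‖ * ‖V.transpose‖ ≤ ‖A‖ * 2 := by
      rw [norm_transpose]
      exact mul_le_mul_of_nonneg_left hVn (norm_nonneg _)
    have e3 := norm_le_norm_add_norm_sub (A * V.transpose) Ahat
    rw [norm_sub_rev] at e3
    have e4 := Matrix.l2_opNorm_mul A V.transpose
    linarith
  have hVV : V'.transpose * V' = 1 := (Matrix.mem_orthogonalGroup_iff' _ ℝ).1 hV'
  have hUU : U' * U'.transpose = 1 := (Matrix.mem_orthogonalGroup_iff _ ℝ).1 hU'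
  refine ⟨U' * R * V' - A, U', V', hU', hV', by abel, ?_, hU1, hV1⟩
  -- Transported back by orthogonal matrices, the backward error is the error of `Ahat` minus the QR
  -- residual: `3 + 2 * 4 * N ≤ 11 * N` multiples of `D₂ * ε * ‖A‖`.
  have e : U' * R * V' - A
      = (Ahat - A * V'.transpose - U' * (U'.transpose * Ahat - R)) * V' := by
    rw [sub_mul, sub_mul, mul_assoc A, hVV, mul_one, mul_sub, ← mul_assoc U', hUU, one_mul,
      sub_mul]
    abel
  have h3 : ‖U' * (U'.transpose * Ahat - R)‖ ≤ 2 * N * D₂ * ε * (4 * ‖A‖) :=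
    (norm_orthogonal_mul_le hU' _).trans
      (hU2.trans (mul_le_mul_of_nonneg_left h2 (by positivity)))
  rw [e]
  refine (Matrix.l2_opNorm_mul _ _).trans ((mul_le_of_le_one_right (norm_nonneg _)
    (norm_orthogonal_le hV')).trans ((norm_sub_le _ _).trans ((add_le_add h1 h3).trans ?_)))
  have h4 : 1 * (D₂ * ε * ‖A‖) ≤ N * (D₂ * ε * ‖A‖) := by gcongr
  linarith

end FloatURV

open FloatURV

/-! ### Choice of the constants -/

theorem mainTheorem6 (mm : FloatURV.SquareMul) (hmm : FloatURV.StableMul mm) :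
    ∃ (K : ℝ) (c : ℕ), ∀ n : ℕ, ∃ ε₀ : ℝ, 0 < ε₀ ∧ ∀ ε : ℝ, 0 < ε → ε ≤ ε₀ →
      ∀ A B U R V : Matrix (Fin n) (Fin n) ℝ, FloatURV.FlRURV mm ε A B U R V →
        ∃ δA Uhat Vhat : Matrix (Fin n) (Fin n) ℝ,
          Uhat ∈ Matrix.orthogonalGroup (Fin n) ℝ ∧ Vhat ∈ Matrix.orthogonalGroup (Fin n) ℝ ∧
          A + δA = Uhat * R * Vhat ∧
          ‖δA‖ ≤ K * (n : ℝ) ^ c * ε * ‖A‖ ∧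
          ‖U - Uhat‖ ≤ K * (n : ℝ) ^ c * ε ∧
          ‖V - Vhat‖ ≤ K * (n : ℝ) ^ c * ε := by
  obtain ⟨C, e, hC, hmul⟩ := hmm.exists_norm_sub_le
  -- Here `576 = 9 * 64` comes from `D` and `G`, and `44 = 11 * 4` from `11 * n * D₂`. The exponent
  -- adds `2 + 3 + 2` for `M`, `G`, `D` and `2` for `n * D₂`.
  refine ⟨44 * (576 * (C + 300) + 1), e + 9, fun n => ?_⟩
  rcases Nat.eq_zero_or_pos n with rfl | hn
  · refine ⟨1, one_pos, fun ε hε _ A B U R V _ => ⟨0, 1, 1, one_mem _, one_mem _,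
      Subsingleton.elim _ _, ?_, ?_, ?_⟩⟩
    · simp
    · rw [Subsingleton.elim (U - 1) 0]; simp
    · rw [Subsingleton.elim (V - 1) 0]; simp
  have hn' : (1 : ℝ) ≤ n := by exact_mod_cast hn
  -- `M` must dominate both the multiplication error `C * n ^ e` and the Householder constant `300 *
  -- n ^ 2`.
  obtain ⟨M, hM⟩ : ∃ M : ℝ, M = (C + 300) * n ^ (e + 2) := ⟨_, rfl⟩
  obtain ⟨G, hG⟩ : ∃ G : ℝ, G = 64 * M * n ^ 3 := ⟨_, rfl⟩
  obtain ⟨D, hD⟩ : ∃ D : ℝ, D = 9 * n ^ 2 * G + 1 := ⟨_, rfl⟩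
  obtain ⟨D₂, hD₂⟩ : ∃ D₂ : ℝ, D₂ = 4 * n * D := ⟨_, rfl⟩
  have hM0 : 0 ≤ M := by rw [hM]; positivity
  have hD0 : 0 ≤ D := by rw [hD, hG]; positivity
  have hne : (1 : ℝ) ≤ n ^ e := one_le_pow₀ hn'
  have hM300 : 300 * (n : ℝ) ^ 2 ≤ M := by
    rw [hM, pow_add, ← mul_assoc]
    refine mul_le_mul_of_nonneg_right ?_ (by positivity)
    nlinarith
  have hCM : C * (n : ℝ) ^ e ≤ M := by
    rw [hM]
    exact mul_le_mul (by linarith) (pow_le_pow_right₀ hn' (by omega)) (by positivity)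
      (by positivity)
  have hDn : D ≤ (576 * (C + 300) + 1) * n ^ (e + 7) := by
    have h1 : (1 : ℝ) ≤ n ^ (e + 7) := one_le_pow₀ hn'
    have h2 : 9 * (n : ℝ) ^ 2 * G = 576 * (C + 300) * n ^ (e + 7) := by rw [hG, hM]; ring
    rw [hD, h2]
    linarith
  have hK : 11 * n * D₂ ≤ 44 * (576 * (C + 300) + 1) * n ^ (e + 9) := by
    calc 11 * n * D₂ = 44 * n ^ 2 * D := by rw [hD₂]; ring
      _ ≤ 44 * n ^ 2 * ((576 * (C + 300) + 1) * n ^ (e + 7)) := by gcongr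
      _ = _ := by ring
  have hD₂0 : 0 ≤ D₂ := by rw [hD₂]; positivity
  have hD₂K : D₂ ≤ 44 * (576 * (C + 300) + 1) * n ^ (e + 9) := by nlinarith
  obtain ⟨ε₀, hε₀, hb⟩ := mem_nhdsGT_iff_exists_Ioc_subset.1
    (((hmul n hn).and (eventually_mul_le_one (1000 * n))).and ((eventually_mul_le_one (24 * n ^ 2 * D ^ 2)).and
      ((eventually_mul_le_one M).and (eventually_mul_le_one D₂))))
  refine ⟨ε₀, hε₀, fun ε hε hεε₀ A B U R V h => ?_⟩
  obtain ⟨⟨h1, h2⟩, h3, h4, h5⟩ := hb ⟨hε, hεε₀⟩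
  have hmulM : MulError mm ε M n := fun p q r hp hq hr A B D hD =>
    (h1 p q r hp hq hr A B D hD).trans (by gcongr)
  obtain ⟨δA, U', V', hU, hV, hA, b1, b2, b3⟩ :=
    h.exists_orthogonal hmulM hε.le hn (by linarith) hM300 hG hD hD₂ h3 h4 h5
  exact ⟨δA, U', V', hU, hV, hA, b1.trans (by gcongr), b2.trans (by gcongr), b3.trans (by gcongr)⟩
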